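/- **Model.** Time is slotted, $t=0,1,2,\dots$. In each slot a job arrives with probability $\lambda\in(0,1)$, independently over slots, and is dispatched at once to one of $K$ first-come-first-served servers. Server $i$ has a queue of infinite capacity, initially empty; whenever it holds a job during a slot (including one that has just arrived), the job at the head departs at the end of the slot with probability $\mu_i\in(0,1)$, independently of everything else. So service times are geometric with parameter $\mu_i$. Assume $\lambda<\sum_{i=1}^K\mu_i$. Let $Q_i(t)$ be the length of queue $i$ (including the job in service) at the beginning of slot $t$; $Q_i(0)=0$. **Optimal routing.** Let $\mathbf p^*$ be the probability vector with $\lambda p_i^*<\mu_i$ for all $i$ that minimizes the expected total steady-state queue length among all policies that send each job to server $i$ with a fixed probability $p_i$, $\lambda p_i<\mu_i$. Let $Q_i^*(t)$ be the queue lengths under the policy with routing vector $\mathbf p^*$, also started empty, and let $r_i=\mu_i-\lambda p_i^*$. **Routing function.** For $\boldsymbol\mu'\in[0,1]^K$ and a set $S$ of servers put $$p_i^{S}=\frac{\mu'_i}{\lambda}-\frac{\sqrt{\mu'_i(1-\mu'_i)}}{\sum_{j\in S}\sqrt{\mu'_j(1-\mu'_j)}}\Big(\frac{\sum_{j\in S}\mu'_j}{\lambda}-1\Big)\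 \ (i\in S),\qquad p_i^{S}=0\ \ (i\notin S),$$ where a fraction $0/0$ is read as $1/|S|$. Start with $S=\{1,\dots,K\}$ and, as long as $p_i^S\le 0$ for some $i\in S$, remove from $S$ its slowest server (all of them in case of a tie). The final set is the support set $\mathcal S(\lambda,\boldsymbol\mu')$ and the final vector is $f(\lambda,\boldsymbol\mu')$. **Policy.** At time $t$ let $\hat\mu_i(t)$ be the number of jobs that have departed from server $i$ divided by the sum of their service times (and an arbitrary fixed number in $[0,1]$ before the first departure). The $\epsilon_t$-exploration policy dispatches a job that arrives in slot $t$ as follows: with probability $\min\{1,K\ln t/t\}$ (read as $0$ for $t=0$) it goes to a uniformly random server, and otherwise to server $i$ with probability $f(\lambda,\hat{\boldsymbol\mu}(t))_i$. Its expected regret up to time $t$ is $$\mathbb E[\Psi(t)]=\mathbb E\Big[\sum_{\tau=1}^{t}\sum_{i=1}^{K}\big(Q_i(\tau)-Q_i^*(\tau)\big)\Big].$$ **Tolerance gap.** $\Delta_{\mathcal S}$ is the supremum of all $\delta\ge0$ such that $\mathcal S(\lambda,\boldsymbol\mu')=\mathcal S(\lambda,\boldsymbol\mu)$ for all $\boldsymbol\mu'\in[0,1]^K$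 with $|\mu'_i-\mu_i|\le\delta$ for all $i$. **Theorem (upper bound on expected regret).** Assume $\Delta_{\mathcal S}>0$. Then there are constants $k_1>0$, $t_0\ge1$ and $C$, depending only on $K$, $\lambda$ and $\boldsymbol\mu$, such that for all integers $t\ge t_0$ (and for every joint distribution of the two systems) $$\mathbb E[\Psi(t)]\le\sum_{\tau=t_0}^{t-1}\Bigg(\sum_{i:\,p_i^*>0}\frac{66\,k_1\ln\tau}{r_i^2}\sqrt{\frac{\ln\tau}{\tau}}+\sum_{i=1}^{K}\frac{132\,\ln^2\tau}{r_i^2\,\tau}\Bigg)+C .$$ -/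

import Mathlib

open MeasureTheory ProbabilityTheory
open scoped ENNReal NNReal BigOperators

noncomputable section

/-! ### Optimal weighted random routing for known rates -/

/-- A coin on `Bool` that shows `true` with probability `r` (clamped to `[0, 1]`). -/
def coin (r : ℝ) : Measure Bool :=
  bernoulliMeasure true false (Set.projIcc (0 : ℝ) 1 zero_le_one r)

/-- `π` is a stationary law of the queue length at slot beginnings of the discrete-time `Geo/Geo/1`
queue with arrival probability `a` and service probability `m`: in a slot the queue length moves
from `n` to `n + A - D` with `A` the arrival, `S` the offered service and `D = S` if `n + A > 0`,
`D = 0` otherwise; with truncated subtraction this is `n + A - S`. -/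
def IsSteadyState (a m : ℝ) (π : Measure ℕ) : Prop :=
  IsProbabilityMeasure π ∧
    (π.prod ((coin a).prod (coin m))).map
      (fun x : ℕ × Bool × Bool => x.1 + x.2.1.toNat - x.2.2.toNat) = π

/-- The expected steady-state queue length of a `Geo/Geo/1` queue. (For `0 ≤ a < m` there is exactly
one steady-state law, so the infimum is over a single value.) -/
def steadyMean (a m : ℝ) : ℝ≥0∞ :=
  ⨅ (π : Measure ℕ) (_ : IsSteadyState a m π), ∫⁻ n, (n : ℝ≥0∞) ∂π

/-- Probability vectors under which all queues are stable. -/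
def IsStableRouting {K : ℕ} (lam : ℝ) (μ p : Fin K → ℝ) : Prop :=
  (∀ i, 0 ≤ p i) ∧ ∑ i, p i = 1 ∧ ∀ i, lam * p i < μ i

/-- `p` is an optimal routing vector for arrival rate `lam` and service rates `μ`: it minimizes the
expected total steady-state queue length over all stable static random routings. Queue `i` is then
a `Geo/Geo/1` queue with arrival probability `lam * p i` and service probability `μ i`. -/
def IsOptimalRouting {K : ℕ} (lam : ℝ) (μ p : Fin K → ℝ) : Prop :=
  IsStableRouting lam μ p ∧
    ∀ q : Fin K → ℝ, IsStableRouting lam μ q →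
      ∑ i, steadyMean (lam * p i) (μ i) ≤ ∑ i, steadyMean (lam * q i) (μ i)

/-! ### The routing function computed from (estimated) rates -/

def spread (m : ℝ) : ℝ := √(m * (1 - m))

/-- The weight of server `i` in the support set `S`: `spread (μ i)` over the sum of the spreads in
`S`, and `1 / #S` in the degenerate case where all rates in `S` are `0` or `1` and this is `0/0`. -/
def share {K : ℕ} (μ : Fin K → ℝ) (S : Finset (Fin K)) (i : Fin K) : ℝ :=
  if ∑ j ∈ S, spread (μ j) = 0 then 1 / (S.card : ℝ)
  else spread (μ i) / ∑ j ∈ S, spread (μ j)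

/-- The closed-form routing vector for a candidate support set `S`. -/
def supportRouting {K : ℕ} (lam : ℝ) (μ : Fin K → ℝ) (S : Finset (Fin K)) (i : Fin K) : ℝ :=
  if i ∈ S then μ i / lam - share μ S i * ((∑ j ∈ S, μ j) / lam - 1) else 0

open Classical in
/-- One round of the search for the support set: if some server of `S` gets a probability `≤ 0`,
the slowest server of `S` (with all servers of `S` tied with it) is removed. -/
def pruneSupport {K : ℕ} (lam : ℝ) (μ : Fin K → ℝ) (S : Finset (Fin K)) : Finset (Fin K) :=
  if ∃ i ∈ S, supportRouting lam μ S i ≤ 0 then S.filter (fun i => ∃ j ∈ S, μ j < μ i) else S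

/-- The optimal support set: start with all servers and prune until nothing changes; as each
effective round removes a server, `K` rounds suffice. -/
def optimalSupport {K : ℕ} (lam : ℝ) (μ : Fin K → ℝ) : Finset (Fin K) :=
  (pruneSupport lam μ)^[K] Finset.univ

/-- The routing function `f(lam, μ)`. -/
def routingVector {K : ℕ} (lam : ℝ) (μ : Fin K → ℝ) : Fin K → ℝ :=
  supportRouting lam μ (optimalSupport lam μ)

/-- The tolerance gap: the supremum of all `δ ≥ 0` such that every rate vector in `[0, 1]^K` within
`δ` of `μ` in each coordinate has the same optimal support set as `μ`. (It can be `∞`.) -/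
def toleranceGap {K : ℕ} (lam : ℝ) (μ : Fin K → ℝ) : ℝ≥0∞ :=
  ⨆ (δ : ℝ≥0) (_ : ∀ μ' : Fin K → ℝ, (∀ i, μ' i ∈ Set.Icc (0 : ℝ) 1) →
    (∀ i, |μ' i - μ i| ≤ δ) → optimalSupport lam μ' = optimalSupport lam μ), (δ : ℝ≥0∞)

/-! ### The queueing system -/

/-- What happened at one server up to the beginning of a slot. -/
structure ServerState where
  /-- number of jobs present, including the one in service -/
  queue : ℕ
  /-- number of jobs that have departed -/
  departed : ℕ
  /-- sum of the service times of the departed jobs -/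
  served : ℕ
  /-- number of past slots that the job at the head of the queue has spent in service -/
  age : ℕ

/-- The empty server. -/
def ServerState.empty : ServerState := ⟨0, 0, 0, 0⟩

/-- One slot at a server: `a` jobs arrive at the beginning of the slot, and if a job is then present,
the job at the head of the queue departs at the end of the slot iff the server offers service. Its
service time is the number of slots it has spent at the head, including this one. -/
def ServerState.next (s : ServerState) (a : ℕ) (service : Bool) : ServerState :=
  if 0 < s.queue + a then
    if service = true then
      ⟨s.queue + a - 1, s.departed + 1, s.served + (s.age + 1), 0⟩
    else ⟨s.queue + a, s.departed, s.served, s.age + 1⟩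
  else s

/-- The estimate (number of departed jobs) / (sum of their service times) of the service rate; before
the first departure it is a preset value `m₀`. -/
def ServerState.estimate (m₀ : ℝ) (s : ServerState) : ℝ :=
  if s.departed = 0 then m₀ else (s.departed : ℝ) / (s.served : ℝ)

/-- Inverse-transform sampling: with `u` uniform on `[0, 1]`, `i` is picked with probability `p i`. -/
def picks {K : ℕ} (p : Fin K → ℝ) (u : ℝ) (i : Fin K) : Prop :=
  ∑ j ∈ Finset.Iio i, p j ≤ u ∧ u < ∑ j ∈ Finset.Iic i, p j

/-- The uniform law on `[0, 1]`. -/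
def unif01 : Measure ℝ := volume.restrict (Set.Icc 0 1)

/-- The exploration probability `min {1, K ln t / t}` in slot `t` (it is `0` in slot `0`). -/
def explorationProb (K t : ℕ) : ℝ := min 1 ((K : ℝ) * Real.log t / t)

/-- The primitive randomness of one slot under the exploration policy:
(arrival, offered services, exploration coin, exploration server, uniform variable for routing). -/
abbrev Slot (K : ℕ) := Bool × (Fin K → Bool) × Bool × Fin K × ℝ

/-- The law of the primitive randomness of slot `t`: the components are independent. -/
def slotLaw {K : ℕ} (lam : ℝ) (μ : Fin K → ℝ) (t : ℕ) : Measure (Slot K) :=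
  (coin lam).prod ((Measure.pi fun i => coin (μ i)).prod
    ((coin (explorationProb K t)).prod ((uniformOn (Set.univ : Set (Fin K))).prod unif01)))

open Classical in
/-- The number of jobs dispatched to server `i` in a slot with primitive randomness `x`, when the
estimated rates are `m`: an arriving job goes to the exploration server if the exploration
coin shows `true`, and otherwise to a server drawn from `routingVector lam m`. -/
def dispatched {K : ℕ} (lam : ℝ) (m : Fin K → ℝ) (x : Slot K) (i : Fin K) : ℕ :=
  match x with
  | (arrival, _, explore, server, u) =>
    if arrival = true ∧
      ((explore = true ∧ server = i) ∨ (explore = false ∧ picks (routingVector lam m) u i))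
    then 1 else 0

/-- The system under the exploration policy at the beginning of slot `t`, along a sequence `x` of
primitive outcomes; `m₀` holds the preset rate estimates. All queues are initially empty. -/
def learningState {K : ℕ} (lam : ℝ) (m₀ : Fin K → ℝ) (x : ℕ → Slot K) : ℕ → Fin K → ServerState
  | 0 => fun _ => ServerState.empty
  | t + 1 => fun i =>
      (learningState lam m₀ x t i).next
        (dispatched lam (fun j => (learningState lam m₀ x t j).estimate (m₀ j)) (x t) i)
        ((x t).2.1 i)

/-- The primitive randomness of one slot under static random routing:
(arrival, offered services, uniform variable for routing). -/
abbrev StaticSlot (K : ℕ) := Bool × (Fin K → Bool) × ℝ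

/-- The law of the primitive randomness of a slot under static random routing. -/
def staticSlotLaw {K : ℕ} (lam : ℝ) (μ : Fin K → ℝ) : Measure (StaticSlot K) :=
  (coin lam).prod ((Measure.pi fun i => coin (μ i)).prod unif01)

open Classical in
/-- The system under static random routing with routing vector `p` at the beginning of slot `t`. -/
def staticState {K : ℕ} (p : Fin K → ℝ) (y : ℕ → StaticSlot K) : ℕ → Fin K → ServerState
  | 0 => fun _ => ServerState.empty
  | t + 1 => fun i =>
      (staticState p y t i).next
        (if (y t).1 = true ∧ picks p (y t).2.2 i then 1 else 0)
        ((y t).2.1 i)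

/-- The regret up to time `t`: the cumulative queue length of the exploration policy minus that of
static random routing with routing vector `p`. -/
def regret {K : ℕ} (lam : ℝ) (m₀ p : Fin K → ℝ) (x : ℕ → Slot K) (y : ℕ → StaticSlot K)
    (t : ℕ) : ℝ :=
  ∑ τ ∈ Finset.Icc 1 t, ∑ i,
    (((learningState lam m₀ x τ i).queue : ℝ) - ((staticState p y τ i).queue : ℝ))

end

/-! ### Coins -/

/-! Expected regret is linear in the two systems, so their joint law is irrelevant and each server
can be treated alone. In either system a server is a queue with a conditional arrival probability `a
t` determined by the past (`IsAdaptiveQueue`), and Q² + Q has the exact one-slot drift 2(Q(a - m) +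
a(1 - m)) (`stepMean_queue`).

For the benchmark, `a` is a constant α. Summing the drift gives T times the stationary mean minus a
bounded term (`sum_integral_queue_of_const`, `energy_le_of_const`). For the learning policy, `a t`
is within C√(log t / t) of the same α except with probability O(t⁻²). The drift then gives at most T
times the same mean plus O(∑ √(log t / t)) (`sum_le_of_drift`,
`IsAdaptiveQueue.sum_integral_queue_le`). The leading terms cancel.

The two systems share α because the optimal vector is the routing function at the true rates
(`IsOptimalRouting.eq_routingVector`): pruning ends at a point satisfying the first-order optimality
conditions of a strictly convex cost.

Closeness of `a t` to α is proved in two stages (`exists_measure_arrivalProb_le`). Exploration alone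
brings of order log² s arrivals to every server by slot s, so an estimate misses a fixed tolerance
with probability exp(-c log² s), which is O(s⁻³). Hence with probability 1 - O(t⁻²) all estimates
are good throughout [t/2, t]. By the tolerance gap the support is then correct on that window, so
each supported server receives linearly many jobs and its rate is known up to O(√(log t / t)). Near
the true rates the routing vector is Lipschitz in the supported rates alone
(`exists_routingVector_close`), so the scarce data on unsupported servers do no harm.

This gives expected regret at most M ∑ √(log τ / τ) + C. Since `k₁` may depend on the rates, the
term of a single supported server already dominates this, with a factor log τ to spare. -/

instance (r : ℝ) : IsProbabilityMeasure (coin r) := by unfold coin; infer_instance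

lemma lintegral_coin {r : ℝ} (h0 : 0 ≤ r) (h1 : r ≤ 1) (g : Bool → ℝ≥0∞) :
    ∫⁻ b, g b ∂coin r = ENNReal.ofReal r * g true + ENNReal.ofReal (1 - r) * g false := by
  have e1 : ((unitInterval.toNNReal (Set.projIcc (0 : ℝ) 1 zero_le_one r) : ℝ≥0) : ℝ≥0∞)
      = ENNReal.ofReal r := by
    rw [Set.projIcc_of_mem _ ⟨h0, h1⟩, ENNReal.ofReal, Real.toNNReal_of_nonneg h0]; rfl
  have e2 : ((unitInterval.toNNReal (unitInterval.symm (Set.projIcc (0 : ℝ) 1 zero_le_one r)) :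
      ℝ≥0) : ℝ≥0∞) = ENNReal.ofReal (1 - r) := by
    rw [Set.projIcc_of_mem _ ⟨h0, h1⟩, ENNReal.ofReal, Real.toNNReal_of_nonneg (by linarith)]; rfl
  rw [coin, bernoulliMeasure_def, lintegral_add_measure, lintegral_smul_measure,
    lintegral_smul_measure, lintegral_dirac, lintegral_dirac, ← e1, ← e2]
  rfl

/-! ### The stationary law of the `Geo/Geo/1` queue -/

lemma map_queue_step_singleton {a m : ℝ} (ha0 : 0 ≤ a) (ha1 : a ≤ 1) (hm0 : 0 ≤ m) (hm1 : m ≤ 1)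
    (π : Measure ℕ) [IsProbabilityMeasure π] (n : ℕ) :
    ((π.prod ((coin a).prod (coin m))).map
      (fun x : ℕ × Bool × Bool => x.1 + x.2.1.toNat - x.2.2.toNat)) {n} =
    ENNReal.ofReal a * (ENNReal.ofReal m * π {n} + ENNReal.ofReal (1 - m) * π {k | k + 1 = n}) +
    ENNReal.ofReal (1 - a) * (ENNReal.ofReal m * π {k | k - 1 = n} +
      ENNReal.ofReal (1 - m) * π {n}) := by
  have hind : ∀ s : Set ℕ, π s = ∫⁻ k, s.indicator 1 k ∂π := fun s => by
    rw [lintegral_indicator_one (by measurability)]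
  rw [← lintegral_indicator_one (measurableSet_singleton n),
    lintegral_map (measurable_of_countable _) (measurable_of_countable _),
    lintegral_prod _ (measurable_of_countable _).aemeasurable]
  simp_rw [lintegral_prod _ (measurable_of_countable _).aemeasurable,
    lintegral_coin ha0 ha1, lintegral_coin hm0 hm1]
  rw [hind {n}, hind {k | k + 1 = n}, hind {k | k - 1 = n}]
  rw [lintegral_add_left (measurable_of_countable _), lintegral_const_mul _ (measurable_of_countable _),
    lintegral_const_mul _ (measurable_of_countable _), lintegral_add_left (measurable_of_countable _),
    lintegral_add_left (measurable_of_countable _), lintegral_const_mul _ (measurable_of_countable _),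
    lintegral_const_mul _ (measurable_of_countable _), lintegral_const_mul _ (measurable_of_countable _),
    lintegral_const_mul _ (measurable_of_countable _)]
  congr 1

lemma map_queue_step_singleton_real {a m : ℝ} (ha0 : 0 ≤ a) (ha1 : a ≤ 1) (hm0 : 0 ≤ m)
    (hm1 : m ≤ 1) (π : Measure ℕ) [IsProbabilityMeasure π] (n : ℕ) :
    ((π.prod ((coin a).prod (coin m))).map
      (fun x : ℕ × Bool × Bool => x.1 + x.2.1.toNat - x.2.2.toNat)).real {n} =
    a * (m * π.real {n} + (1 - m) * π.real {k | k + 1 = n}) +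
    (1 - a) * (m * π.real {k | k - 1 = n} + (1 - m) * π.real {n}) := by
  have h2 : 0 ≤ 1 - a := by linarith
  have h3 : 0 ≤ 1 - m := by linarith
  rw [measureReal_def, map_queue_step_singleton ha0 ha1 hm0 hm1]
  rw [← ofReal_measureReal (μ := π) (s := {n}), ← ofReal_measureReal (μ := π) (s := {k | k + 1 = n}),
    ← ofReal_measureReal (μ := π) (s := {k | k - 1 = n})]
  rw [← ENNReal.ofReal_mul hm0, ← ENNReal.ofReal_mul h3, ← ENNReal.ofReal_mul h3,
    ← ENNReal.ofReal_mul hm0, ← ENNReal.ofReal_add (by positivity) (by positivity),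
    ← ENNReal.ofReal_add (by positivity) (by positivity),
    ← ENNReal.ofReal_mul ha0, ← ENNReal.ofReal_mul h2,
    ← ENNReal.ofReal_add (by positivity) (by positivity), ENNReal.toReal_ofReal (by positivity)]

/-- The global balance equations telescope to the equality of flows across each cut between n and n
+ 1. Truncated subtraction only affects the equation at 0, which starts the induction. -/
lemma isSteadyState_iff_balance {a m : ℝ} (ha0 : 0 ≤ a) (ha1 : a ≤ 1) (hm0 : 0 ≤ m)
    (hm1 : m ≤ 1) (π : Measure ℕ) [IsProbabilityMeasure π] :
    IsSteadyState a m π ↔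
      ∀ n, π.real {n} * (a * (1 - m)) = π.real {n + 1} * (m * (1 - a)) := by
  have key : IsSteadyState a m π ↔ ∀ n, a * (m * π.real {n} + (1 - m) * π.real {k | k + 1 = n}) +
    (1 - a) * (m * π.real {k | k - 1 = n} + (1 - m) * π.real {n}) = π.real {n} := by
    have : IsProbabilityMeasure ((π.prod ((coin a).prod (coin m))).map
      (fun x : ℕ × Bool × Bool => x.1 + x.2.1.toNat - x.2.2.toNat)) :=
      Measure.isProbabilityMeasure_map (measurable_of_countable _).aemeasurable
    simp_rw [← map_queue_step_singleton_real ha0 ha1 hm0 hm1]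
    constructor
    · rintro ⟨-, h⟩ n
      rw [h]
    · intro h
      refine ⟨inferInstance, Measure.ext_iff_singleton.2 fun n => ?_⟩
      have := h n
      rwa [measureReal_def, measureReal_def, ENNReal.toReal_eq_toReal_iff' (by simp) (by simp)]
        at this
  have s0 : π.real {k | k + 1 = 0} = 0 := by simp
  have s1 : ∀ n, {k | k + 1 = n + 1} = ({n} : Set ℕ) := fun n => by ext; simp
  have s2 : ∀ n, {k | k - 1 = n + 1} = ({n + 2} : Set ℕ) := fun n => by ext; simp
  have s3 : π.real {k | k - 1 = 0} = π.real {0} + π.real {1} := by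
    have : {k | k - 1 = 0} = ({0} ∪ {1} : Set ℕ) := by ext; simp; omega
    rw [this, measureReal_union (by simp) (by simp)]
  rw [key]
  constructor
  · intro h n
    induction n with
    | zero =>
      have := h 0
      rw [s0, s3] at this
      linear_combination -this
    | succ n ih =>
      have := h (n + 1)
      rw [s1, s2] at this
      linear_combination ih - this
  · intro h n
    cases n with
    | zero =>
      rw [s0, s3]
      linear_combination - h 0
    | succ n =>
      rw [s1, s2]
      linear_combination h n - h (n + 1)

lemma lintegral_cast_eq_of_geometric {ρ : ℝ} (h0 : 0 ≤ ρ) (h1 : ρ < 1) (π : Measure ℕ)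
    [IsProbabilityMeasure π] (h : ∀ n, π.real {n} = (1 - ρ) * ρ ^ n) :
    ∫⁻ n, (n : ℝ≥0∞) ∂π = ENNReal.ofReal (ρ / (1 - ρ)) := by
  have hn : ‖ρ‖ < 1 := by rwa [Real.norm_of_nonneg h0]
  have hs := (hasSum_coe_mul_geometric_of_norm_lt_one hn).mul_left (1 - ρ)
  have h2 : 0 < 1 - ρ := by linarith
  rw [lintegral_countable']
  have : ∀ n : ℕ, (n : ℝ≥0∞) * π {n} = ENNReal.ofReal ((1 - ρ) * (n * ρ ^ n)) := fun n => by
    rw [← ofReal_measureReal, h n, ← ENNReal.ofReal_natCast, ← ENNReal.ofReal_mul (by positivity)]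
    ring_nf
  simp_rw [this]
  rw [← ENNReal.ofReal_tsum_of_nonneg (fun n => by positivity) hs.summable, hs.tsum_eq]
  congr 1
  field_simp

lemma isProbabilityMeasure_geometric {ρ : ℝ} (h0 : 0 ≤ ρ) (h1 : ρ < 1) :
    IsProbabilityMeasure
      (Measure.sum fun n : ℕ => ENNReal.ofReal ((1 - ρ) * ρ ^ n) • Measure.dirac n) := by
  constructor
  have h2 : 0 < 1 - ρ := by linarith
  have hs := (hasSum_geometric_of_lt_one h0 h1).mul_left (1 - ρ)
  rw [Measure.sum_apply _ MeasurableSet.univ]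
  simp only [Measure.smul_apply, measure_univ, smul_eq_mul, mul_one]
  rw [← ENNReal.ofReal_tsum_of_nonneg (fun n => by positivity) hs.summable, hs.tsum_eq,
    mul_inv_cancel₀ h2.ne', ENNReal.ofReal_one]

lemma measureReal_geometric_singleton {ρ : ℝ} (h0 : 0 ≤ ρ) (h1 : ρ < 1) (n : ℕ) :
    (Measure.sum fun n : ℕ => ENNReal.ofReal ((1 - ρ) * ρ ^ n) • Measure.dirac n).real {n} =
      (1 - ρ) * ρ ^ n := by
  have h2 : 0 < 1 - ρ := by linarith
  rw [measureReal_def, Measure.sum_apply _ (measurableSet_singleton n), tsum_eq_single n]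
  · rw [Measure.smul_apply, smul_eq_mul, Measure.dirac_apply_of_mem (Set.mem_singleton n), mul_one,
      ENNReal.toReal_ofReal (by positivity)]
  · intro k hk
    simp [hk]

lemma hasSum_measureReal_singleton (π : Measure ℕ) [IsProbabilityMeasure π] :
    HasSum (fun n => π.real {n}) 1 := by
  have h : ∑' n : ℕ, π {n} = 1 := by
    have := lintegral_countable' (μ := π) (fun _ => 1)
    simpa using this.symm
  have := ENNReal.hasSum_toReal (f := fun n => π {n}) (by rw [h]; simp)
  rwa [← ENNReal.tsum_toReal_eq (by simp), h] at this

/-- The mean of the stationary queue length. -/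
noncomputable def geoMean (a m : ℝ) : ℝ := a * (1 - m) / (m - a)

/-- Detailed balance forces the geometric law with ratio a(1 - m) / (m(1 - a)), so the infimum
ranges over a single value, which is attained. -/
lemma steadyMean_eq {a m : ℝ} (ha : 0 ≤ a) (ham : a < m) (hm : m < 1) :
    steadyMean a m = ENNReal.ofReal (geoMean a m) := by
  have hm0 : 0 < m := by linarith
  have ha1 : 0 < 1 - a := by linarith
  have hm1 : 0 < 1 - m := by linarith
  have hd : 0 < m * (1 - a) := by positivity
  set ρ := a * (1 - m) / (m * (1 - a)) with hρ
  have h0 : 0 ≤ ρ := by positivity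
  have h1 : ρ < 1 := by rw [hρ, div_lt_one hd]; nlinarith
  have hρm : ρ * (m * (1 - a)) = a * (1 - m) := by rw [hρ]; field_simp
  have hgeo : ρ / (1 - ρ) = geoMean a m := by
    have : m - a ≠ 0 := by linarith
    have h3 : 1 - ρ ≠ 0 := by linarith
    rw [geoMean, div_eq_div_iff h3 this]
    have : ρ * (m - a) = ρ * (m * (1 - a)) - ρ * (a * (1 - m)) := by ring
    rw [this, hρm]; ring
  have hmean : ∀ π : Measure ℕ, IsSteadyState a m π →
      ∫⁻ n, (n : ℝ≥0∞) ∂π = ENNReal.ofReal (geoMean a m) := by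
    intro π hπ
    have := hπ.1
    have hb := (isSteadyState_iff_balance ha (by linarith) hm0.le hm.le π).1 hπ
    have hpow : ∀ n, π.real {n} = π.real {0} * ρ ^ n := by
      intro n
      induction n with
      | zero => simp
      | succ n ih =>
        have := hb n
        rw [← hρm, ← mul_assoc] at this
        rw [← mul_right_cancel₀ hd.ne' this, ih]; ring
    have hs := hasSum_measureReal_singleton π
    have hs2 := (hasSum_geometric_of_lt_one h0 h1).mul_left (π.real {0})
    simp_rw [← hpow] at hs2
    have h3 : (1 - ρ) ≠ 0 := by linarith
    have hπ0 : π.real {0} = 1 - ρ := by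
      have := hs2.unique hs
      field_simp at this
      linarith
    rw [lintegral_cast_eq_of_geometric h0 h1 π (fun n => by rw [hpow, hπ0]), hgeo]
  apply le_antisymm
  · have := isProbabilityMeasure_geometric h0 h1
    have hst : IsSteadyState a m
        (Measure.sum fun n : ℕ => ENNReal.ofReal ((1 - ρ) * ρ ^ n) • Measure.dirac n) := by
      rw [isSteadyState_iff_balance ha (by linarith) hm0.le hm.le]
      intro n
      rw [measureReal_geometric_singleton h0 h1, measureReal_geometric_singleton h0 h1, ← hρm]
      ring
    exact (iInf₂_le _ hst).trans (hmean _ hst).le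
  · exact le_iInf₂ fun π hπ => (hmean π hπ).ge

/-! ### The support set -/

lemma spread_pos {m : ℝ} (h : 0 < m ∧ m < 1) : 0 < spread m :=
  Real.sqrt_pos.2 (mul_pos h.1 (by linarith))

lemma spread_sq {m : ℝ} (h : 0 < m ∧ m < 1) : spread m ^ 2 = m * (1 - m) :=
  Real.sq_sqrt (mul_nonneg h.1.le (by linarith))

/-- Squaring turns `m ≤ c * spread m` into m ≤ c²(1 - m), which is inherited by smaller m. This is
why it is safe to prune the slowest server even when another one has the nonpositive probability. -/
lemma le_mul_spread_of_le {m m' c : ℝ} (h : 0 < m ∧ m < 1) (h' : 0 < m' ∧ m' < 1)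
    (hle : m' ≤ m) (hm : m ≤ c * spread m) : m' ≤ c * spread m' := by
  have hs := spread_pos h
  have hs' := spread_pos h'
  have hc : 0 < c := pos_of_mul_pos_left (h.1.trans_le hm) hs.le
  have h1 : m ^ 2 ≤ c ^ 2 * (m * (1 - m)) := by
    rw [← spread_sq h, ← mul_pow]; exact pow_le_pow_left₀ h.1.le hm 2
  have h2 : m ≤ c ^ 2 * (1 - m) := by
    have : m * m ≤ m * (c ^ 2 * (1 - m)) := by nlinarith
    exact le_of_mul_le_mul_left this h.1
  have h3 : m' ≤ c ^ 2 * (1 - m') := by nlinarith [sq_nonneg c]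
  refine le_of_sq_le_sq ?_ (by positivity)
  rw [mul_pow, spread_sq h']
  nlinarith [h'.1]

/-- The value of `(μ i - lam * p i) / spread (μ i)` common to all servers of the support. -/
noncomputable def supportLevel {K : ℕ} (lam : ℝ) (μ : Fin K → ℝ) (S : Finset (Fin K)) : ℝ :=
  (∑ j ∈ S, μ j - lam) / ∑ j ∈ S, spread (μ j)

section Support

variable {K : ℕ} {lam : ℝ} {μ : Fin K → ℝ} {S : Finset (Fin K)}

lemma sum_spread_pos (hμ : ∀ i, 0 < μ i ∧ μ i < 1) (hS : S.Nonempty) :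
    0 < ∑ j ∈ S, spread (μ j) := Finset.sum_pos (fun j _ => spread_pos (hμ j)) hS

lemma supportLevel_mul (hμ : ∀ i, 0 < μ i ∧ μ i < 1) (hS : S.Nonempty) :
    supportLevel lam μ S * ∑ j ∈ S, spread (μ j) = ∑ j ∈ S, μ j - lam :=
  div_mul_cancel₀ _ (sum_spread_pos hμ hS).ne'

lemma mul_supportRouting (hlam : 0 < lam) (hμ : ∀ i, 0 < μ i ∧ μ i < 1) {i : Fin K} (hi : i ∈ S) :
    lam * supportRouting lam μ S i = μ i - supportLevel lam μ S * spread (μ i) := by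
  have := (sum_spread_pos hμ ⟨i, hi⟩).ne'
  rw [supportRouting, if_pos hi, share, if_neg this, supportLevel]
  field_simp

lemma supportRouting_nonpos_iff (hlam : 0 < lam) (hμ : ∀ i, 0 < μ i ∧ μ i < 1) {i : Fin K}
    (hi : i ∈ S) : supportRouting lam μ S i ≤ 0 ↔ μ i ≤ supportLevel lam μ S * spread (μ i) := by
  have h := mul_supportRouting hlam hμ hi
  constructor
  · intro h'
    linarith [mul_nonpos_of_nonneg_of_nonpos hlam.le h']
  · intro h'
    exact nonpos_of_mul_nonpos_right (by linarith) hlam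

/-- What pruning preserves: the remaining servers can carry the load, and a removed server would
receive no jobs at the current level. -/
structure IsSupportCandidate (lam : ℝ) (μ : Fin K → ℝ) (S : Finset (Fin K)) : Prop where
  nonempty : S.Nonempty
  load : lam < ∑ j ∈ S, μ j
  removed : ∀ i ∉ S, μ i ≤ supportLevel lam μ S * spread (μ i)

lemma IsSupportCandidate.level_pos (hμ : ∀ i, 0 < μ i ∧ μ i < 1)
    (h : IsSupportCandidate lam μ S) : 0 < supportLevel lam μ S :=
  div_pos (sub_pos.2 h.load) (sum_spread_pos hμ h.nonempty)

/-- Every removed server satisfies `μ j ≤ c * spread (μ j)` at the old level c, so its removal can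
only raise the level. The earlier removals therefore remain justified, and a positive level means
that the remaining servers carry the load. -/
lemma IsSupportCandidate.pruneSupport (hlam : 0 < lam) (hμ : ∀ i, 0 < μ i ∧ μ i < 1)
    (h : IsSupportCandidate lam μ S) : IsSupportCandidate lam μ (pruneSupport lam μ S) := by
  classical
  by_cases hex : ∃ i ∈ S, supportRouting lam μ S i ≤ 0
  swap
  · rwa [_root_.pruneSupport, if_neg hex]
  obtain ⟨i, hi, hneg⟩ := hex
  rw [supportRouting_nonpos_iff hlam hμ hi] at hneg
  set c := supportLevel lam μ S with hc
  have hc0 : 0 < c := h.level_pos hμ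
  set S' := _root_.pruneSupport lam μ S with hS'
  have hS'f : S' = S.filter (fun i => ∃ j ∈ S, μ j < μ i) := by
    rw [hS', _root_.pruneSupport, if_pos ⟨i, hi, (supportRouting_nonpos_iff hlam hμ hi).2 hneg⟩]
  have hsub : S' ⊆ S := hS'f ▸ Finset.filter_subset _ _
  have hrem : ∀ j ∈ S \ S', μ j ≤ c * spread (μ j) := by
    intro j hj
    rw [hS'f, Finset.mem_sdiff, Finset.mem_filter] at hj
    have hji : μ j ≤ μ i := by
      by_contra hlt
      exact hj.2 ⟨hj.1, i, hi, not_le.1 hlt⟩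
    exact le_mul_spread_of_le (hμ i) (hμ j) hji hneg
  have hsum : c * ∑ j ∈ S', spread (μ j) ≤ ∑ j ∈ S', μ j - lam := by
    have h1 := Finset.sum_le_sum hrem
    rw [← Finset.mul_sum] at h1
    have h2 := Finset.sum_sdiff (f := μ) hsub
    have h3 := Finset.sum_sdiff (f := fun j => spread (μ j)) hsub
    have h4 := supportLevel_mul (lam := lam) hμ h.nonempty
    rw [← h3, ← h2, mul_add] at h4
    linarith
  have hne : S'.Nonempty := by
    by_contra hne
    rw [Finset.not_nonempty_iff_eq_empty] at hne
    rw [hne] at hsum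
    simp at hsum
    linarith
  have hpos := sum_spread_pos hμ hne
  have hcc : c ≤ supportLevel lam μ S' := by
    rw [supportLevel, le_div_iff₀ hpos]; exact hsum
  refine ⟨hne, ?_, fun j hj => ?_⟩
  · have := mul_pos hc0 hpos
    linarith
  · have : μ j ≤ c * spread (μ j) := by
      by_cases hjS : j ∈ S
      · exact hrem j (Finset.mem_sdiff.2 ⟨hjS, hj⟩)
      · exact h.removed j hjS
    exact this.trans (mul_le_mul_of_nonneg_right hcc (spread_pos (hμ j)).le)

lemma card_pruneSupport_lt (hS : S.Nonempty) (hex : ∃ i ∈ S, supportRouting lam μ S i ≤ 0) :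
    (pruneSupport lam μ S).card < S.card := by
  classical
  obtain ⟨j, hj, hmin⟩ := S.exists_min_image μ hS
  rw [pruneSupport, if_pos hex]
  refine Finset.card_lt_card ⟨Finset.filter_subset _ _, fun hle => ?_⟩
  obtain ⟨-, k, hk, hlt⟩ := Finset.mem_filter.1 (hle hj)
  exact absurd (hmin k hk) (not_le.2 hlt)

lemma pruneSupport_of_forall_pos (h : ∀ i ∈ S, 0 < supportRouting lam μ S i) :
    pruneSupport lam μ S = S := by
  rw [pruneSupport, if_neg]
  push Not
  exact h

/-- The second alternative counts effective rounds. After K of them the set would be empty, which a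
candidate never is, so the first alternative holds at the end. -/
lemma iterate_pruneSupport (hlam : 0 < lam) (hμ : ∀ i, 0 < μ i ∧ μ i < 1)
    (hstable : lam < ∑ i, μ i) (n : ℕ) :
    IsSupportCandidate lam μ ((pruneSupport lam μ)^[n] Finset.univ) ∧
      ((∀ i ∈ (pruneSupport lam μ)^[n] Finset.univ,
        0 < supportRouting lam μ ((pruneSupport lam μ)^[n] Finset.univ) i) ∨
        ((pruneSupport lam μ)^[n] Finset.univ).card + n ≤ K) := by
  induction n with
  | zero =>
    have hne : (Finset.univ : Finset (Fin K)).Nonempty := by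
      by_contra hne
      rw [Finset.not_nonempty_iff_eq_empty] at hne
      rw [hne] at hstable
      simp at hstable
      linarith
    exact ⟨⟨hne, hstable, fun i hi => absurd (Finset.mem_univ i) hi⟩, Or.inr (by simp)⟩
  | succ n ih =>
    rw [Function.iterate_succ_apply']
    refine ⟨ih.1.pruneSupport hlam hμ, ?_⟩
    by_cases hpos : ∀ i ∈ (pruneSupport lam μ)^[n] Finset.univ,
        0 < supportRouting lam μ ((pruneSupport lam μ)^[n] Finset.univ) i
    · left
      rwa [pruneSupport_of_forall_pos hpos]
    · right
      have h1 := ih.2.resolve_left hpos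
      push Not at hpos
      have := card_pruneSupport_lt ih.1.nonempty hpos
      omega

lemma isSupportCandidate_optimalSupport (hlam : 0 < lam) (hμ : ∀ i, 0 < μ i ∧ μ i < 1)
    (hstable : lam < ∑ i, μ i) : IsSupportCandidate lam μ (optimalSupport lam μ) :=
  (iterate_pruneSupport hlam hμ hstable K).1

lemma routingVector_pos (hlam : 0 < lam) (hμ : ∀ i, 0 < μ i ∧ μ i < 1)
    (hstable : lam < ∑ i, μ i) {i : Fin K} (hi : i ∈ optimalSupport lam μ) :
    0 < routingVector lam μ i := by
  obtain ⟨h1, h2⟩ := iterate_pruneSupport hlam hμ hstable K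
  rcases h2 with h2 | h2
  · exact h2 i hi
  · have := h1.nonempty.card_pos
    omega

/-- The degenerate 0/0 branch is included because estimated rates may equal 0 or 1. -/
lemma sum_share {μ : Fin K → ℝ} (hS : S.Nonempty) : ∑ i ∈ S, share μ S i = 1 := by
  by_cases h : ∑ j ∈ S, spread (μ j) = 0
  · simp only [share, if_pos h, Finset.sum_const, nsmul_eq_mul]
    have : (S.card : ℝ) ≠ 0 := by exact_mod_cast hS.card_pos.ne'
    field_simp
  · simp only [share, if_neg h]
    rw [← Finset.sum_div, div_self h]

lemma sum_supportRouting {μ : Fin K → ℝ} (hS : S.Nonempty) : ∑ i, supportRouting lam μ S i = 1 := by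
  have : ∑ i, supportRouting lam μ S i =
      ∑ i ∈ S, (μ i / lam - share μ S i * ((∑ j ∈ S, μ j) / lam - 1)) := by
    simp only [supportRouting]
    rw [Finset.sum_ite_mem, Finset.univ_inter]
  rw [this, Finset.sum_sub_distrib, ← Finset.sum_mul, sum_share hS, ← Finset.sum_div]
  ring

lemma isStableRouting_routingVector (hlam : 0 < lam) (hμ : ∀ i, 0 < μ i ∧ μ i < 1)
    (hstable : lam < ∑ i, μ i) : IsStableRouting lam μ (routingVector lam μ) := by
  have hc := isSupportCandidate_optimalSupport hlam hμ hstable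
  refine ⟨fun i => ?_, sum_supportRouting hc.nonempty, fun i => ?_⟩
  · by_cases hi : i ∈ optimalSupport lam μ
    · exact (routingVector_pos hlam hμ hstable hi).le
    · rw [routingVector, supportRouting, if_neg hi]
  · by_cases hi : i ∈ optimalSupport lam μ
    · rw [routingVector, mul_supportRouting hlam hμ hi]
      have := mul_pos (hc.level_pos hμ) (spread_pos (hμ i))
      linarith
    · rw [routingVector, supportRouting, if_neg hi, mul_zero]
      exact (hμ i).1

/-- The tangent inequality of the convex function `a ↦ geoMean a m`. -/
lemma geoMean_eq_tangent_add {a b m : ℝ} (ha : a < m) (hb : b < m) :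
    geoMean b m + m * (1 - m) / (m - b) ^ 2 * (a - b) +
      m * (1 - m) * (a - b) ^ 2 / ((m - a) * (m - b) ^ 2) = geoMean a m := by
  have h1 : m - a ≠ 0 := by linarith
  have h2 : m - b ≠ 0 := by linarith
  unfold geoMean
  field_simp
  ring

/-- The optimal routing vector is the one computed by the routing function. -/
theorem IsOptimalRouting.eq_routingVector {p : Fin K → ℝ} (hlam : 0 < lam)
    (hμ : ∀ i, 0 < μ i ∧ μ i < 1) (hstable : lam < ∑ i, μ i) (hp : IsOptimalRouting lam μ p) :
    p = routingVector lam μ := by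
  obtain ⟨⟨hp0, hp1, hpμ⟩, hopt⟩ := hp
  set q := routingVector lam μ with hq
  have hqs := isStableRouting_routingVector hlam hμ hstable
  have hle := hopt q hqs
  obtain ⟨hq0, hq1, hqμ⟩ := hqs
  have hgeo : ∀ r : Fin K → ℝ, (∀ i, 0 ≤ r i) → (∀ i, lam * r i < μ i) →
      ∑ i, steadyMean (lam * r i) (μ i) = ENNReal.ofReal (∑ i, geoMean (lam * r i) (μ i)) ∧
        ∀ i, 0 ≤ geoMean (lam * r i) (μ i) := by
    intro r hr0 hrμ
    have hnn : ∀ i, 0 ≤ geoMean (lam * r i) (μ i) := fun i =>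
      div_nonneg (mul_nonneg (mul_nonneg hlam.le (hr0 i)) (by linarith [(hμ i).2]))
        (by linarith [hrμ i])
    refine ⟨?_, hnn⟩
    rw [ENNReal.ofReal_sum_of_nonneg fun i _ => hnn i]
    exact Finset.sum_congr rfl fun i _ =>
      steadyMean_eq (mul_nonneg hlam.le (hr0 i)) (hrμ i) (hμ i).2
  rw [(hgeo p hp0 hpμ).1, (hgeo q hq0 hqμ).1, ENNReal.ofReal_le_ofReal_iff
    (Finset.sum_nonneg fun i _ => (hgeo q hq0 hqμ).2 i)] at hle
  have hcand := isSupportCandidate_optimalSupport hlam hμ hstable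
  set c := supportLevel lam μ (optimalSupport lam μ) with hcdef
  have hc : 0 < c := hcand.level_pos hμ
  -- First-order optimality with multiplier lam / c²: the marginal cost at q equals it on the
  -- support and is at least as large off it, where q i = 0 and p i can only exceed q i. The
  -- multiplier terms cancel in the sum since p and q both sum to 1.
  have hterm : ∀ i, geoMean (lam * q i) (μ i) + lam / c ^ 2 * (p i - q i) +
      μ i * (1 - μ i) * (lam * p i - lam * q i) ^ 2 /
        ((μ i - lam * p i) * (μ i - lam * q i) ^ 2) ≤ geoMean (lam * p i) (μ i) := by
    intro i
    rw [← geoMean_eq_tangent_add (hpμ i) (hqμ i), ← mul_sub]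
    have : lam / c ^ 2 * (p i - q i) ≤
        μ i * (1 - μ i) / (μ i - lam * q i) ^ 2 * (lam * (p i - q i)) := by
      by_cases hi : i ∈ optimalSupport lam μ
      · have h1 : μ i - lam * q i = c * spread (μ i) := by
          rw [hq, routingVector, mul_supportRouting hlam hμ hi]; ring
        have := (spread_pos (hμ i)).ne'
        rw [h1, ← spread_sq (hμ i)]
        apply le_of_eq
        field_simp
      · have h1 : q i = 0 := by rw [hq, routingVector, supportRouting, if_neg hi]
        have h2 := hcand.removed i hi
        have h3 : μ i ^ 2 ≤ c ^ 2 * (μ i * (1 - μ i)) := by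
          rw [← spread_sq (hμ i), ← mul_pow]; exact pow_le_pow_left₀ (hμ i).1.le h2 2
        have h4 : 1 / c ^ 2 ≤ μ i * (1 - μ i) / μ i ^ 2 := by
          rw [div_le_div_iff₀ (by positivity) (pow_pos (hμ i).1 2)]
          linarith
        rw [h1]
        simp only [mul_zero, sub_zero]
        calc lam / c ^ 2 * p i = 1 / c ^ 2 * (lam * p i) := by ring
          _ ≤ _ := mul_le_mul_of_nonneg_right h4 (mul_nonneg hlam.le (hp0 i))
    linarith
  have hsum := Finset.sum_le_sum fun i (_ : i ∈ Finset.univ) => hterm i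
  rw [Finset.sum_add_distrib, Finset.sum_add_distrib, ← Finset.mul_sum, Finset.sum_sub_distrib,
    hp1, hq1] at hsum
  have hnn : ∀ i ∈ Finset.univ, 0 ≤ μ i * (1 - μ i) * (lam * p i - lam * q i) ^ 2 /
        ((μ i - lam * p i) * (μ i - lam * q i) ^ 2) := fun i _ =>
    div_nonneg (mul_nonneg (mul_nonneg (hμ i).1.le (by linarith [(hμ i).2])) (sq_nonneg _))
      (mul_nonneg (by linarith [hpμ i]) (sq_nonneg _))
  -- Optimality of p leaves no room for the quadratic remainders of the tangent inequality, so each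
  -- vanishes and p = q.
  have hzero := (Finset.sum_eq_zero_iff_of_nonneg hnn).1
    (le_antisymm (by linarith) (Finset.sum_nonneg hnn))
  funext i
  have h1 := hzero i (Finset.mem_univ i)
  have h2 := hpμ i
  have h3 := hqμ i
  have h4 : μ i * (1 - μ i) ≠ 0 := (mul_pos (hμ i).1 (by linarith [(hμ i).2])).ne'
  have h5 : (μ i - lam * p i) * (μ i - lam * q i) ^ 2 ≠ 0 :=
    (mul_pos (by linarith) (pow_pos (by linarith) 2)).ne'
  rw [div_eq_zero_iff, or_iff_left h5, mul_eq_zero, or_iff_right h4, sq_eq_zero_iff, ← mul_sub,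
    mul_eq_zero, or_iff_right hlam.ne', sub_eq_zero] at h1
  exact h1

end Support

/-! ### A single server with adaptive arrivals -/

instance : MeasurableSpace ServerState := ⊤

instance : DiscreteMeasurableSpace ServerState := ⟨fun _ => trivial⟩

instance : Countable ServerState :=
  Function.Injective.countable
    (f := fun s : ServerState => (s.queue, s.departed, s.served, s.age))
    (by rintro ⟨⟩ ⟨⟩ h; simpa using h)

namespace ServerState

/-- The number of slots in which the server was busy. -/
def busySlots (s : ServerState) : ℕ := s.served + s.age

/-- The number of jobs that have arrived. -/
def arrivals (s : ServerState) : ℕ := s.queue + s.departed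

/-- The number of departures minus its compensator. -/
def excess (m : ℝ) (s : ServerState) : ℝ := s.departed - m * s.busySlots

lemma arrivals_next (s : ServerState) (d : ℕ) (b : Bool) :
    (s.next d b).arrivals = s.arrivals + d := by
  unfold next arrivals
  split_ifs <;> simp <;> omega

lemma busySlots_next (s : ServerState) (d : ℕ) (b : Bool) :
    (s.next d b).busySlots = s.busySlots + if 0 < s.queue + d then 1 else 0 := by
  unfold next busySlots
  split_ifs <;> simp <;> omega

lemma queue_next_le (s : ServerState) (d : ℕ) (b : Bool) :
    (s.next d b).queue ≤ s.queue + d := by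
  unfold next
  split_ifs <;> simp

lemma age_next_eq_zero (s : ServerState) (d : ℕ) (b : Bool) (h : s.queue = 0 → s.age = 0)
    (hq : (s.next d b).queue = 0) : (s.next d b).age = 0 := by
  unfold next at *
  split_ifs at * <;> simp_all

/-- The mean of `g` after one slot in which a job arrives with probability `a` and, independently,
service is offered with probability `m`. -/
noncomputable def stepMean (m a : ℝ) (g : ServerState → ℝ) (s : ServerState) : ℝ :=
  a * (m * g (s.next 1 true) + (1 - m) * g (s.next 1 false)) +
    (1 - a) * (m * g (s.next 0 true) + (1 - m) * g (s.next 0 false))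

lemma stepMean_nonneg {m a : ℝ} {g : ServerState → ℝ} (hm : 0 ≤ m ∧ m ≤ 1) (ha : a ∈ Set.Icc 0 1)
    (hg : ∀ s, 0 ≤ g s) (s : ServerState) : 0 ≤ stepMean m a g s := by
  have h1 : 0 ≤ 1 - m := by linarith
  have h2 : 0 ≤ 1 - a := by linarith [ha.2]
  have h3 := hm.1
  have h4 := ha.1
  have := hg (s.next 1 true)
  have := hg (s.next 1 false)
  have := hg (s.next 0 true)
  have := hg (s.next 0 false)
  unfold stepMean
  positivity

end ServerState

open ServerState

/-- `X` is the state of a server with service probability `m`, to which a job is sent in slot `t`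
with a conditional probability `a t` that may depend on the past. -/
structure IsAdaptiveQueue {Ω : Type*} [mΩ : MeasurableSpace Ω] (P : Measure Ω)
    (ℱ : Filtration ℕ mΩ) (m : ℝ) (X : ℕ → Ω → ServerState) (a : ℕ → Ω → ℝ) : Prop where
  zero : ∀ ω, X 0 ω = ServerState.empty
  succ : ∀ t ω, ∃ d ≤ 1, ∃ b, X (t + 1) ω = (X t ω).next d b
  measurable_state : ∀ t, Measurable[ℱ t] (X t)
  measurable_prob : ∀ t, Measurable[ℱ t] (a t)
  prob_mem : ∀ t ω, a t ω ∈ Set.Icc (0 : ℝ) 1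
  -- The conditional law of the next state, tested against arbitrary nonnegative weights V from the
  -- past; no conditional expectation has to be formed.
  step : ∀ t (V : Ω → ℝ≥0∞) (g : ServerState → ℝ), Measurable[ℱ t] V → (∀ s, 0 ≤ g s) →
    ∫⁻ ω, V ω * ENNReal.ofReal (g (X (t + 1) ω)) ∂P =
      ∫⁻ ω, V ω * ENNReal.ofReal (stepMean m (a t ω) g (X t ω)) ∂P

namespace IsAdaptiveQueue

variable {Ω : Type*} [mΩ : MeasurableSpace Ω] {P : Measure Ω} {ℱ : Filtration ℕ mΩ} {m : ℝ}
  {X : ℕ → Ω → ServerState} {a : ℕ → Ω → ℝ}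

/-! ### Pathwise invariants and exponential tail bounds -/

section

variable (h : IsAdaptiveQueue P ℱ m X a)
include h

lemma measurable (t : ℕ) : Measurable (X t) := (h.measurable_state t).mono (ℱ.le t) le_rfl

lemma measurable_comp {β : Type*} [MeasurableSpace β] (g : ServerState → β) (t : ℕ) :
    Measurable fun ω => g (X t ω) := (measurable_of_countable g).comp (h.measurable t)

lemma measurable_a (t : ℕ) : Measurable (a t) := (h.measurable_prob t).mono (ℱ.le t) le_rfl

lemma invariant {p : ℕ → ServerState → Prop} (h0 : p 0 ServerState.empty)
    (hs : ∀ t s d b, d ≤ 1 → p t s → p (t + 1) (s.next d b)) (t : ℕ) (ω : Ω) : p t (X t ω) := by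
  induction t with
  | zero => rw [h.zero]; exact h0
  | succ t ih =>
    obtain ⟨d, hd, b, he⟩ := h.succ t ω
    rw [he]
    exact hs t _ d b hd ih

lemma age_eq_zero (t : ℕ) (ω : Ω) : (X t ω).queue = 0 → (X t ω).age = 0 :=
  h.invariant (p := fun _ s => s.queue = 0 → s.age = 0) (fun _ => rfl)
    (fun _ s d b _ hs => age_next_eq_zero s d b hs) t ω

/-- At most one job arrives per slot, and its arrival makes that slot busy. Lower bounds on arrivals
thus become lower bounds on the sample size of the estimate. -/
lemma arrivals_le_busySlots (t : ℕ) (ω : Ω) : (X t ω).arrivals ≤ (X t ω).busySlots :=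
  h.invariant (p := fun _ s => s.arrivals ≤ s.busySlots) le_rfl
    (fun _ s d b hd hs => by
      rw [arrivals_next, busySlots_next]
      split_ifs <;> omega) t ω

lemma queue_le (t : ℕ) (ω : Ω) : (X t ω).queue ≤ t :=
  h.invariant (p := fun t s => s.queue ≤ t) le_rfl
    (fun t s d b hd hs => (queue_next_le s d b).trans (by omega)) t ω

lemma lintegral_succ (t : ℕ) {g : ServerState → ℝ} (hg : ∀ s, 0 ≤ g s) :
    ∫⁻ ω, ENNReal.ofReal (g (X (t + 1) ω)) ∂P =
      ∫⁻ ω, ENNReal.ofReal (stepMean m (a t ω) g (X t ω)) ∂P := by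
  simpa using h.step t (fun _ => 1) g measurable_const hg

/-- The exponential supermartingale that controls the excess. -/
lemma lintegral_exp_excess_le [IsProbabilityMeasure P] (hm : 0 < m ∧ m < 1) {θ : ℝ} (hθ : |θ| ≤ 1)
    (t : ℕ) :
    ∫⁻ ω, ENNReal.ofReal (Real.exp (θ * (X t ω).excess m - θ ^ 2 * (X t ω).busySlots)) ∂P ≤ 1 := by
  -- Moment generating function of a centred coin, from e^x ≤ 1 + x + x² for |x| ≤ 1; the linear
  -- terms cancel. A busy slot thus costs at most θ², and an idle slot leaves the state unchanged.
  have hexp : m * Real.exp (θ * (1 - m)) + (1 - m) * Real.exp (-(θ * m)) ≤ Real.exp (θ ^ 2) := by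
    have hle : ∀ c, |c| ≤ 1 → Real.exp (θ * c) ≤ 1 + θ * c + θ ^ 2 := by
      intro c hc
      have h1 : |θ * c| ≤ 1 := by rw [abs_mul]; exact mul_le_one₀ hθ (abs_nonneg _) hc
      have h2 := (abs_le.1 (Real.abs_exp_sub_one_sub_id_le h1)).2
      have h3 : (θ * c) ^ 2 ≤ θ ^ 2 := by
        rw [mul_pow]
        exact mul_le_of_le_one_right (sq_nonneg _) ((sq_le_one_iff_abs_le_one c).2 hc)
      linarith
    have h1 := hle (1 - m) (abs_le.2 ⟨by linarith, by linarith⟩)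
    have h2 := hle (-m) (abs_le.2 ⟨by linarith, by linarith⟩)
    have h3 := Real.add_one_le_exp (θ ^ 2)
    rw [mul_neg] at h2
    nlinarith
  induction t with
  | zero => simp [h.zero, ServerState.empty, excess, busySlots]
  | succ t ih =>
    rw [h.lintegral_succ t (g := fun s => Real.exp (θ * s.excess m - θ ^ 2 * s.busySlots))
      (fun s => (Real.exp_pos _).le)]
    refine le_trans (lintegral_mono fun ω => ENNReal.ofReal_le_ofReal ?_) ih
    obtain ⟨ha0, ha1⟩ := h.prob_mem t ω
    generalize a t ω = a at ha0 ha1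
    generalize X t ω = s
    set E := Real.exp (θ * s.excess m - θ ^ 2 * s.busySlots) with hE
    have hbusy : ∀ d, 0 < s.queue + d →
        m * Real.exp (θ * (s.next d true).excess m - θ ^ 2 * (s.next d true).busySlots) +
          (1 - m) * Real.exp (θ * (s.next d false).excess m - θ ^ 2 * (s.next d false).busySlots)
          ≤ E := by
      intro d hd
      have e1 : Real.exp (θ * (s.next d true).excess m - θ ^ 2 * (s.next d true).busySlots) =
          E * Real.exp (-θ ^ 2) * Real.exp (θ * (1 - m)) := by
        rw [hE, ← Real.exp_add, ← Real.exp_add, excess, busySlots_next, if_pos hd, excess]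
        have : (s.next d true).departed = s.departed + 1 := by simp [ServerState.next, hd]
        rw [this]
        push_cast
        ring_nf
      have e2 : Real.exp (θ * (s.next d false).excess m - θ ^ 2 * (s.next d false).busySlots) =
          E * Real.exp (-θ ^ 2) * Real.exp (-(θ * m)) := by
        rw [hE, ← Real.exp_add, ← Real.exp_add, excess, busySlots_next, if_pos hd, excess]
        have : (s.next d false).departed = s.departed := by simp [ServerState.next, hd]
        rw [this]
        push_cast
        ring_nf
      rw [e1, e2]
      have hEpos : 0 < E * Real.exp (-θ ^ 2) := by positivity
      calc _ = E * Real.exp (-θ ^ 2) *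
            (m * Real.exp (θ * (1 - m)) + (1 - m) * Real.exp (-(θ * m))) := by ring
        _ ≤ E * Real.exp (-θ ^ 2) * Real.exp (θ ^ 2) := mul_le_mul_of_nonneg_left hexp hEpos.le
        _ = E := by rw [mul_assoc, ← Real.exp_add]; simp
    have h0 : m * Real.exp (θ * (s.next 0 true).excess m - θ ^ 2 * (s.next 0 true).busySlots) +
          (1 - m) * Real.exp (θ * (s.next 0 false).excess m - θ ^ 2 * (s.next 0 false).busySlots)
          ≤ E := by
      by_cases hq : 0 < s.queue + 0
      · exact hbusy 0 hq
      · have : ∀ b, s.next 0 b = s := fun b => by rw [ServerState.next, if_neg hq]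
        rw [this, this]
        linarith
    have h1 := hbusy 1 (by omega)
    unfold stepMean
    nlinarith

/-- Markov's inequality for the supermartingale at θ = ±δ/2: the exponent is at least δ²N/2 - δ²N/4
≥ δ²n/4 with N the busy slots. The random N sits inside the exponent, so no union over its values is
needed. -/
lemma measure_excess_le [IsProbabilityMeasure P] (hm : 0 < m ∧ m < 1) {δ : ℝ} (hδ0 : 0 ≤ δ)
    (hδ1 : δ ≤ 2) (n : ℝ) (t : ℕ) :
    P {ω | n ≤ (X t ω).busySlots ∧ δ * (X t ω).busySlots ≤ |(X t ω).excess m|} ≤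
      ENNReal.ofReal (2 * Real.exp (-(δ ^ 2 * n / 4))) := by
  have key : ∀ σ : ℝ, |σ| = 1 →
      P {ω | n ≤ (X t ω).busySlots ∧ δ * (X t ω).busySlots ≤ σ * (X t ω).excess m} ≤
      ENNReal.ofReal (Real.exp (-(δ ^ 2 * n / 4))) := by
    intro σ hσ
    have hσ2 : σ ^ 2 = 1 := by rw [← sq_abs, hσ, one_pow]
    have hθ : |δ / 2 * σ| ≤ 1 := by
      rw [abs_mul, hσ, mul_one, abs_of_nonneg (by linarith)]; linarith
    have h1 := h.lintegral_exp_excess_le hm hθ t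
    have h2 := mul_meas_ge_le_lintegral (μ := P) (f := fun ω => ENNReal.ofReal
      (Real.exp (δ / 2 * σ * (X t ω).excess m - (δ / 2 * σ) ^ 2 * (X t ω).busySlots)))
      (h.measurable_comp (fun s => ENNReal.ofReal
        (Real.exp (δ / 2 * σ * s.excess m - (δ / 2 * σ) ^ 2 * s.busySlots))) t)
      (ENNReal.ofReal (Real.exp (δ ^ 2 * n / 4)))
    have h3 := h2.trans h1
    rw [Real.exp_neg, ENNReal.ofReal_inv_of_pos (Real.exp_pos _)]
    refine le_trans (measure_mono ?_) (ENNReal.le_inv_iff_mul_le.2 (by rwa [mul_comm]))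
    rintro ω ⟨hn, hM⟩
    apply ENNReal.ofReal_le_ofReal
    apply Real.exp_le_exp.2
    rw [mul_pow, hσ2]
    nlinarith [sq_nonneg δ, mul_le_mul_of_nonneg_left hM hδ0]
  calc _ ≤ P ({ω | n ≤ (X t ω).busySlots ∧ δ * (X t ω).busySlots ≤ 1 * (X t ω).excess m} ∪
        {ω | n ≤ (X t ω).busySlots ∧ δ * (X t ω).busySlots ≤ (-1) * (X t ω).excess m}) := by
        refine measure_mono ?_
        rintro ω ⟨hn, hM⟩
        rcases le_abs.1 hM with hM | hM
        · left; exact ⟨hn, by linarith⟩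
        · right; exact ⟨hn, by linarith⟩
    _ ≤ _ := (measure_union_le _ _).trans (add_le_add (key 1 (by simp)) (key (-1) (by simp)))
    _ = _ := by
        rw [← ENNReal.ofReal_add (Real.exp_pos _).le (Real.exp_pos _).le]
        ring_nf

/-- The exponential supermartingale that controls the number of arrivals from below. -/
lemma lintegral_exp_arrivals_le [IsProbabilityMeasure P] (hm : 0 < m ∧ m < 1) (t : ℕ) :
    ∫⁻ ω, ENNReal.ofReal (Real.exp ((∑ s ∈ Finset.range t, a s ω) / 2)) *
      ENNReal.ofReal (Real.exp (-((X t ω).arrivals : ℝ))) ∂P ≤ 1 := by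
  induction t with
  | zero => simp [h.zero, ServerState.empty, arrivals]
  | succ t ih =>
    have hmeas : Measurable[ℱ t] fun ω => ENNReal.ofReal
        (Real.exp ((∑ s ∈ Finset.range (t + 1), a s ω) / 2)) := by
      refine ENNReal.measurable_ofReal.comp (Real.measurable_exp.comp (Measurable.div_const ?_ 2))
      refine Finset.measurable_sum _ fun s hs => ?_
      exact (h.measurable_prob s).mono (ℱ.mono (Nat.lt_succ_iff.1 (Finset.mem_range.1 hs))) le_rfl
    rw [h.step t _ (fun s => Real.exp (-(s.arrivals : ℝ))) hmeas (fun s => (Real.exp_pos _).le)]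
    refine le_trans (lintegral_mono fun ω => ?_) ih
    rw [← ENNReal.ofReal_mul (Real.exp_pos _).le, ← ENNReal.ofReal_mul (Real.exp_pos _).le]
    apply ENNReal.ofReal_le_ofReal
    rw [Finset.sum_range_succ]
    obtain ⟨ha0, ha1⟩ := h.prob_mem t ω
    generalize a t ω = b at ha0 ha1
    generalize X t ω = s
    generalize ∑ s ∈ Finset.range t, a s ω = A
    have e1 : stepMean m b (fun s => Real.exp (-(s.arrivals : ℝ))) s =
        (1 - b * (1 - Real.exp (-1))) * Real.exp (-(s.arrivals : ℝ)) := by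
      simp only [stepMean, arrivals_next]
      push_cast
      rw [neg_add, Real.exp_add, add_zero]
      ring
    rw [e1, add_div, Real.exp_add]
    -- As 1 - 1/e > 1/2, the factor is at most 1 - b/2 ≤ exp(-b/2).
    have h1 : Real.exp (b / 2) * (1 - b * (1 - Real.exp (-1))) ≤ 1 := by
      have h2 : Real.exp (-1) < 1 / 2 := by
        have := Real.exp_neg_one_lt_d9
        linarith
      have h3 : 1 - b * (1 - Real.exp (-1)) ≤ Real.exp (-(b / 2)) := by
        have := Real.add_one_le_exp (-(b / 2))
        nlinarith
      calc _ ≤ Real.exp (b / 2) * Real.exp (-(b / 2)) :=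
            mul_le_mul_of_nonneg_left h3 (Real.exp_pos _).le
        _ = 1 := by rw [← Real.exp_add]; simp
    calc _ = Real.exp (b / 2) * (1 - b * (1 - Real.exp (-1))) *
          (Real.exp (A / 2) * Real.exp (-(s.arrivals : ℝ))) := by ring
      _ ≤ 1 * (Real.exp (A / 2) * Real.exp (-(s.arrivals : ℝ))) :=
          mul_le_mul_of_nonneg_right h1 (by positivity)
      _ = _ := one_mul _

/-- On this event the exponent of the arrival supermartingale is at least 2n - n = n, and Markov's
inequality applies. -/
lemma measure_arrivals_le [IsProbabilityMeasure P] (hm : 0 < m ∧ m < 1) (n : ℝ) (t : ℕ) :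
    P {ω | ((X t ω).arrivals : ℝ) ≤ n ∧ 4 * n ≤ ∑ s ∈ Finset.range t, a s ω} ≤
      ENNReal.ofReal (Real.exp (-n)) := by
  have h1 := h.lintegral_exp_arrivals_le hm t
  have hmeas : Measurable fun ω =>
      ENNReal.ofReal (Real.exp ((∑ s ∈ Finset.range t, a s ω) / 2)) *
      ENNReal.ofReal (Real.exp (-((X t ω).arrivals : ℝ))) := by
    refine Measurable.mul (ENNReal.measurable_ofReal.comp (Real.measurable_exp.comp
      (Measurable.div_const ?_ 2)))
      (h.measurable_comp (fun s => ENNReal.ofReal (Real.exp (-(s.arrivals : ℝ)))) t)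
    exact Finset.measurable_sum _ fun s _ => h.measurable_a s
  have h2 := mul_meas_ge_le_lintegral (μ := P) hmeas (ENNReal.ofReal (Real.exp n))
  have h3 := h2.trans h1
  rw [Real.exp_neg, ENNReal.ofReal_inv_of_pos (Real.exp_pos _)]
  refine le_trans (measure_mono ?_) (ENNReal.le_inv_iff_mul_le.2 (by rwa [mul_comm]))
  rintro ω ⟨hn, hM⟩
  rw [Set.mem_ofPred_eq, ← ENNReal.ofReal_mul (Real.exp_pos _).le, ← Real.exp_add]
  apply ENNReal.ofReal_le_ofReal
  apply Real.exp_le_exp.2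
  linarith

/-- In a busy slot the age resets with probability m and otherwise grows by one, and (1 - m)(1 +
m/2) ≤ 1 - m/2. So the mean obeys x ↦ 1 + (1 - m/2)x, whose fixed point is 2/m. In an idle slot the
state is frozen, which is harmless because an empty queue has age 0. -/
lemma lintegral_exp_age_le [IsProbabilityMeasure P] (hm : 0 < m ∧ m < 1) (t : ℕ) :
    ∫⁻ ω, ENNReal.ofReal ((1 + m / 2) ^ (X t ω).age) ∂P ≤ ENNReal.ofReal (2 / m) := by
  obtain ⟨hm0, hm1⟩ := hm
  induction t with
  | zero =>
    simp only [h.zero, ServerState.empty, pow_zero, ENNReal.ofReal_one, lintegral_const,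
      measure_univ, mul_one]
    rw [← ENNReal.ofReal_one]
    apply ENNReal.ofReal_le_ofReal
    rw [le_div_iff₀ hm0]
    linarith
  | succ t ih =>
    rw [h.lintegral_succ t (g := fun s => (1 + m / 2) ^ s.age) (fun s => by positivity)]
    calc _ ≤ ∫⁻ ω, (1 + ENNReal.ofReal (1 - m / 2) *
            ENNReal.ofReal ((1 + m / 2) ^ (X t ω).age)) ∂P := by
          refine lintegral_mono fun ω => ?_
          rw [← ENNReal.ofReal_mul (by linarith), ← ENNReal.ofReal_one,
            ← ENNReal.ofReal_add zero_le_one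
              (mul_nonneg (by linarith) (by positivity))]
          apply ENNReal.ofReal_le_ofReal
          have hage := h.age_eq_zero t ω
          obtain ⟨ha0, ha1⟩ := h.prob_mem t ω
          generalize a t ω = b at ha0 ha1
          generalize X t ω = s at hage
          have hE : 0 ≤ (1 + m / 2) ^ s.age := by positivity
          have hbusy : ∀ d, 0 < s.queue + d →
              m * (1 + m / 2) ^ (s.next d true).age +
                (1 - m) * (1 + m / 2) ^ (s.next d false).age ≤
              1 + (1 - m / 2) * (1 + m / 2) ^ s.age := by
            intro d hd
            have e1 : (s.next d true).age = 0 := by simp [ServerState.next, hd]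
            have e2 : (s.next d false).age = s.age + 1 := by simp [ServerState.next, hd]
            rw [e1, e2, pow_zero, pow_succ]
            nlinarith [mul_nonneg (sq_nonneg m) hE]
          have h0 : m * (1 + m / 2) ^ (s.next 0 true).age +
                (1 - m) * (1 + m / 2) ^ (s.next 0 false).age ≤
              1 + (1 - m / 2) * (1 + m / 2) ^ s.age := by
            by_cases hq : 0 < s.queue + 0
            · exact hbusy 0 hq
            · have : ∀ b, s.next 0 b = s := fun b => by rw [ServerState.next, if_neg hq]
              rw [this, this, hage (by omega)]
              simp
              linarith
          have h1 := hbusy 1 (by omega)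
          unfold stepMean
          nlinarith
      _ = 1 + ENNReal.ofReal (1 - m / 2) *
            ∫⁻ ω, ENNReal.ofReal ((1 + m / 2) ^ (X t ω).age) ∂P := by
          rw [lintegral_add_left measurable_const, lintegral_const, measure_univ, mul_one,
            lintegral_const_mul _
              (h.measurable_comp (fun s => ENNReal.ofReal ((1 + m / 2) ^ s.age)) t)]
      _ ≤ 1 + ENNReal.ofReal (1 - m / 2) * ENNReal.ofReal (2 / m) := by gcongr
      _ = ENNReal.ofReal (2 / m) := by
          have : 0 ≤ 1 - m / 2 := by linarith
          rw [← ENNReal.ofReal_mul this, ← ENNReal.ofReal_one,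
            ← ENNReal.ofReal_add zero_le_one (by positivity)]
          congr 1
          field_simp
          ring

lemma measure_age_ge_le [IsProbabilityMeasure P] (hm : 0 < m ∧ m < 1) (x : ℝ) (t : ℕ) :
    P {ω | x ≤ (X t ω).age} ≤
      ENNReal.ofReal (2 / m * Real.exp (-(Real.log (1 + m / 2) * x))) := by
  have hm0 := hm.1
  have h1 := h.lintegral_exp_age_le hm t
  have h2 := mul_meas_ge_le_lintegral (μ := P)
    (f := fun ω => ENNReal.ofReal ((1 + m / 2) ^ (X t ω).age))
    (h.measurable_comp (fun s => ENNReal.ofReal ((1 + m / 2) ^ s.age)) t)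
    (ENNReal.ofReal (Real.exp (Real.log (1 + m / 2) * x)))
  have h3 := h2.trans h1
  rw [Real.exp_neg, ← div_eq_mul_inv, ENNReal.ofReal_div_of_pos (Real.exp_pos _),
    ENNReal.le_div_iff_mul_le (Or.inl (by simp [Real.exp_pos])) (Or.inl (by simp)), mul_comm]
  refine le_trans ?_ h3
  gcongr with ω
  intro hx
  apply ENNReal.ofReal_le_ofReal
  rw [← Real.exp_log (show 0 < (1 + m / 2) by positivity), ← Real.exp_nat_mul, Real.log_exp]
  apply Real.exp_le_exp.2
  rw [mul_comm]
  have : 0 ≤ Real.log (1 + m / 2) := Real.log_nonneg (by linarith)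
  exact mul_le_mul_of_nonneg_right hx this

end

end IsAdaptiveQueue

/-! ### Drift of the queue length -/

namespace IsAdaptiveQueue

variable {Ω : Type*} [mΩ : MeasurableSpace Ω] {P : Measure Ω} {ℱ : Filtration ℕ mΩ} {m : ℝ}
  {X : ℕ → Ω → ServerState} {a : ℕ → Ω → ℝ} (h : IsAdaptiveQueue P ℱ m X a)
include h

lemma integrable_queue [IsProbabilityMeasure P] (t : ℕ) :
    Integrable (fun ω => ((X t ω).queue : ℝ)) P := by
  refine Integrable.of_bound (h.measurable_comp (fun s => (s.queue : ℝ)) t).aestronglyMeasurable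
    (t : ℝ) (ae_of_all _ fun ω => ?_)
  rw [Real.norm_of_nonneg (by positivity)]
  exact_mod_cast h.queue_le t ω

lemma integrable_queue_sq [IsProbabilityMeasure P] (t : ℕ) :
    Integrable (fun ω => ((X t ω).queue : ℝ) ^ 2) P := by
  refine Integrable.of_bound
    (h.measurable_comp (fun s => (s.queue : ℝ) ^ 2) t).aestronglyMeasurable
    ((t : ℝ) ^ 2) (ae_of_all _ fun ω => ?_)
  rw [Real.norm_of_nonneg (by positivity)]
  have : ((X t ω).queue : ℝ) ≤ t := by exact_mod_cast h.queue_le t ω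
  gcongr

lemma integral_succ (hm : 0 ≤ m ∧ m ≤ 1) (t : ℕ) {g : ServerState → ℝ} (hg : ∀ s, 0 ≤ g s) :
    ∫ ω, g (X (t + 1) ω) ∂P = ∫ ω, stepMean m (a t ω) g (X t ω) ∂P := by
  have hmeas : Measurable fun ω => stepMean m (a t ω) g (X t ω) := by
    have ha := h.measurable_a t
    have h1 := fun d b => h.measurable_comp (fun s => g (s.next d b)) t
    exact (ha.mul (((h1 1 true).const_mul _).add ((h1 1 false).const_mul _))).add
      ((measurable_const.sub ha).mul (((h1 0 true).const_mul _).add ((h1 0 false).const_mul _)))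
  rw [integral_eq_lintegral_of_nonneg_ae (ae_of_all _ fun ω => hg _)
      (h.measurable_comp g (t + 1)).aestronglyMeasurable,
    integral_eq_lintegral_of_nonneg_ae
      (ae_of_all _ fun ω => stepMean_nonneg hm (h.prob_mem t ω) hg _) hmeas.aestronglyMeasurable,
    h.lintegral_succ t hg]

omit h in
-- With q(q + 1) in place of q², a departure changes the function by -2q, which vanishes by itself
-- at q = 0. The drift is therefore an identity with no boundary term for the empty queue.
lemma stepMean_queue (m a : ℝ) (s : ServerState) :
    stepMean m a (fun s => (s.queue : ℝ) ^ 2 + s.queue) s =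
      (s.queue : ℝ) ^ 2 + s.queue + 2 * (s.queue * (a - m) + a * (1 - m)) := by
  obtain ⟨q, d, v, e⟩ := s
  cases q with
  | zero => simp [stepMean, ServerState.next]; ring
  | succ q => simp [stepMean, ServerState.next]; ring

omit h in
/-- The Lyapunov function of the drift argument, in expectation. -/
noncomputable def energy (P : Measure Ω) (X : ℕ → Ω → ServerState) (t : ℕ) : ℝ :=
  ∫ ω, (((X t ω).queue : ℝ) ^ 2 + (X t ω).queue) ∂P

omit h in
lemma energy_nonneg (t : ℕ) : 0 ≤ energy P X t := integral_nonneg fun ω => by positivity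

lemma energy_le [IsProbabilityMeasure P] (t : ℕ) : energy P X t ≤ (t : ℝ) ^ 2 + t := by
  have : energy P X t ≤ ∫ _, ((t : ℝ) ^ 2 + t) ∂P := by
    refine integral_mono ((h.integrable_queue_sq t).add (h.integrable_queue t))
      (integrable_const _) fun ω => ?_
    have : ((X t ω).queue : ℝ) ≤ t := by exact_mod_cast h.queue_le t ω
    dsimp only
    gcongr
  simpa using this

lemma integrable_drift [IsProbabilityMeasure P] (t : ℕ) (c d : ℝ) :
    Integrable (fun ω => (a t ω - c) * ((X t ω).queue + d)) P := by
  have hb : ∀ ω, ‖a t ω - c‖ ≤ 1 + |c| := fun ω => by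
    have h1 := h.prob_mem t ω
    rw [Real.norm_eq_abs]
    calc |a t ω - c| ≤ |a t ω| + |c| := abs_sub _ _
      _ ≤ 1 + |c| := by rw [abs_of_nonneg h1.1]; linarith [h1.2]
  exact ((h.integrable_queue t).add (integrable_const d)).bdd_mul
    ((h.measurable_a t).sub_const c).aestronglyMeasurable (ae_of_all _ hb)

lemma energy_succ [IsProbabilityMeasure P] (hm : 0 ≤ m ∧ m ≤ 1) (α : ℝ) (t : ℕ) :
    energy P X (t + 1) = energy P X t - 2 * (m - α) * ∫ ω, ((X t ω).queue : ℝ) ∂P +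
      2 * (α * (1 - m)) + 2 * ∫ ω, (a t ω - α) * ((X t ω).queue + (1 - m)) ∂P := by
  have hq := h.integrable_queue t
  have hq2 := h.integrable_queue_sq t
  have h1 := h.integral_succ hm t (g := fun s => (s.queue : ℝ) ^ 2 + s.queue)
    (fun s => by positivity)
  simp_rw [stepMean_queue] at h1
  have h2 : ∀ ω, ((X t ω).queue : ℝ) ^ 2 + (X t ω).queue +
      2 * ((X t ω).queue * (a t ω - m) + a t ω * (1 - m)) =
      (((X t ω).queue : ℝ) ^ 2 + (X t ω).queue) + ((-2 * (m - α)) * (X t ω).queue +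
        (2 * (α * (1 - m)) + 2 * ((a t ω - α) * ((X t ω).queue + (1 - m))))) := fun ω => by ring
  simp_rw [h2] at h1
  have hd := (h.integrable_drift t α (1 - m)).const_mul 2
  rw [show energy P X (t + 1) = _ from h1, integral_add (by exact hq2.add hq)
      (by exact (hq.const_mul _).add ((integrable_const _).add hd)),
    show ∫ ω, (((X t ω).queue : ℝ) ^ 2 + (X t ω).queue) ∂P = energy P X t from rfl,
    integral_add (by exact hq.const_mul _) (by exact (integrable_const _).add hd),
    integral_add (integrable_const _) hd, integral_const_mul]
  rw [integral_const_mul 2 fun ω => (a t ω - α) * (((X t ω).queue : ℝ) + (1 - m))]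
  simp only [integral_const, probReal_univ, one_smul]
  ring

/-- The error term of the drift if the arrival probability is usually close to `α`. -/
lemma integral_drift_le [IsProbabilityMeasure P] (hm : 0 ≤ m ∧ m ≤ 1) {α δ π : ℝ}
    (hα : α ∈ Set.Icc (0 : ℝ) 1) (hδ : 0 ≤ δ) (hπ : 0 ≤ π) (t : ℕ)
    (hP : P {ω | δ < |a t ω - α|} ≤ ENNReal.ofReal π) :
    ∫ ω, (a t ω - α) * ((X t ω).queue + (1 - m)) ∂P ≤
      δ * (∫ ω, ((X t ω).queue : ℝ) ∂P + 1) + π * (t + 1) := by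
  set B := {ω | δ < |a t ω - α|} with hB
  have hBm : MeasurableSet B := by
    have : Measurable fun ω => |a t ω - α| := ((h.measurable_a t).sub_const α).abs
    exact measurableSet_lt measurable_const this
  have hq := h.integrable_queue t
  have hi1 : Integrable (fun ω => δ * (((X t ω).queue : ℝ) + 1)) P :=
    (hq.add (integrable_const 1)).const_mul δ
  have hi2 : Integrable (B.indicator fun _ => (t : ℝ) + 1) P :=
    (integrable_const _).indicator hBm
  have h1 : ∫ ω, (a t ω - α) * ((X t ω).queue + (1 - m)) ∂P ≤
      ∫ ω, (δ * (((X t ω).queue : ℝ) + 1) + B.indicator (fun _ => (t : ℝ) + 1) ω) ∂P := by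
    refine integral_mono (h.integrable_drift t α (1 - m)) (hi1.add hi2) fun ω => ?_
    have hQ : ((X t ω).queue : ℝ) ≤ t := by exact_mod_cast h.queue_le t ω
    have hQ0 : 0 ≤ ((X t ω).queue : ℝ) := by positivity
    have ha := h.prob_mem t ω
    dsimp only
    by_cases hω : ω ∈ B
    · rw [Set.indicator_of_mem hω]
      -- On the bad event only the trivial bounds remain: the deviation is at most 1 and the queue
      -- at most t.
      have h3 : a t ω - α ≤ 1 := by linarith [ha.2, hα.1]
      have h4 : 0 ≤ δ * (((X t ω).queue : ℝ) + 1) := by positivity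
      have h5 : (a t ω - α) * ((X t ω).queue + (1 - m)) ≤ 1 * ((X t ω).queue + (1 - m)) :=
        mul_le_mul_of_nonneg_right h3 (by linarith)
      linarith
    · rw [Set.indicator_of_notMem hω, add_zero]
      have h3 : |a t ω - α| ≤ δ := not_lt.1 hω
      calc _ ≤ δ * ((X t ω).queue + (1 - m)) :=
            mul_le_mul_of_nonneg_right ((le_abs_self _).trans h3) (by linarith)
        _ ≤ _ := mul_le_mul_of_nonneg_left (by linarith) hδ
  refine h1.trans ?_
  rw [integral_add hi1 hi2, integral_const_mul, integral_add hq (integrable_const 1),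
    integral_indicator hBm]
  have h2 : P.real B ≤ π := ENNReal.toReal_le_of_le_ofReal hπ hP
  have h3 : P.real B * ((t : ℝ) + 1) ≤ π * (t + 1) := mul_le_mul_of_nonneg_right h2 (by positivity)
  simpa using h3

/-! ### Constant arrival probability -/

/-- With η = (m - α)/2, the function (1 + η)^Q contracts by 1 - η²/(1 + η) up to an additive 1 + η;
the fixed point of this recursion is ((1 + η)/η)². The exponential then dominates Q² + Q. -/
lemma energy_le_of_const [IsProbabilityMeasure P] (hm : 0 < m ∧ m < 1) {α : ℝ} (hα0 : 0 ≤ α)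
    (hαm : α < m) (ha : ∀ t ω, a t ω = α) (t : ℕ) :
    energy P X t ≤ (2 / Real.log (1 + (m - α) / 2) ^ 2 + 1 / Real.log (1 + (m - α) / 2)) *
      ((1 + (m - α) / 2) / ((m - α) / 2)) ^ 2 := by
  obtain ⟨η, hη⟩ : ∃ η, η = (m - α) / 2 := ⟨_, rfl⟩
  have hη0 : 0 < η := by rw [hη]; linarith
  have hαm2 : m = α + 2 * η := by rw [hη]; ring
  rw [← hη]
  set θ := Real.log (1 + η) with hθ
  have hθ0 : 0 < θ := Real.log_pos (by linarith)
  set C := 2 / θ ^ 2 + 1 / θ with hC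
  have hC0 : 0 < C := by positivity
  have hint : ∀ t, Integrable (fun ω => (1 + η) ^ (X t ω).queue) P := fun t => by
    refine Integrable.of_bound
      (h.measurable_comp (fun s => (1 + η) ^ s.queue) t).aestronglyMeasurable
      ((1 + η) ^ t) (ae_of_all _ fun ω => ?_)
    rw [Real.norm_of_nonneg (by positivity)]
    exact pow_le_pow_right₀ (by linarith) (h.queue_le t ω)
  have hstep : ∀ s, stepMean m α (fun s => (1 + η) ^ s.queue) s ≤
      (1 - η ^ 2 / (1 + η)) * (1 + η) ^ s.queue + (1 + η) := by
    rintro ⟨q, d, v, e⟩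
    have hκ : η ^ 2 / (1 + η) ≤ 1 := by
      rw [div_le_one (by linarith)]
      nlinarith
    have hα1 : α ≤ 1 := by linarith
    have hm1 : 0 ≤ 1 - m := by linarith
    have ham : α * (1 - m) ≤ 1 := mul_le_one₀ hα1 hm1 (by linarith)
    cases q with
    | zero =>
      simp [stepMean, ServerState.next]
      nlinarith
    | succ q =>
      simp [stepMean, ServerState.next]
      have hy : 0 < (1 + η) ^ q := by positivity
      have e1 : (1 - η ^ 2 / (1 + η)) * (1 + η) ^ (q + 1) = (1 + η - η ^ 2) * (1 + η) ^ q := by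
        have : 1 + η ≠ 0 := by linarith
        rw [pow_succ]; field_simp; ring
      rw [e1, pow_succ _ (q + 1), pow_succ _ q]
      have e2 : α * (m * (1 + η) + (1 - m) * ((1 + η) * (1 + η))) +
          (1 - α) * (m + (1 - m) * (1 + η)) ≤ 1 + η - η ^ 2 := by
        have : 0 ≤ η ^ 2 * (1 - α * (1 - m)) := mul_nonneg (sq_nonneg _) (by linarith)
        have : α * (m * (1 + η) + (1 - m) * ((1 + η) * (1 + η))) +
          (1 - α) * (m + (1 - m) * (1 + η)) = 1 + η + η * (α * (1 - m) * η - (m - α)) := by ring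
        rw [this, hη]
        rw [hη] at *
        nlinarith
      have := mul_le_mul_of_nonneg_right e2 hy.le
      linarith
  have hexp : ∀ t, ∫ ω, (1 + η) ^ (X t ω).queue ∂P ≤ ((1 + η) / η) ^ 2 := by
    intro t
    induction t with
    | zero =>
      simp only [h.zero, ServerState.empty, pow_zero]
      simp only [integral_const, probReal_univ, smul_eq_mul, mul_one]
      apply one_le_pow₀
      rw [one_le_div hη0]
      linarith
    | succ t ih =>
      rw [h.integral_succ ⟨hm.1.le, hm.2.le⟩ t (g := fun s => (1 + η) ^ s.queue)
        (fun s => by positivity)]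
      simp_rw [ha]
      calc _ ≤ ∫ ω, ((1 - η ^ 2 / (1 + η)) * (1 + η) ^ (X t ω).queue + (1 + η)) ∂P := by
            refine integral_mono_of_nonneg (ae_of_all _ fun ω => ?_)
              (((hint t).const_mul _).add (integrable_const _)) (ae_of_all _ fun ω => hstep _)
            exact stepMean_nonneg ⟨hm.1.le, hm.2.le⟩ ⟨hα0, by linarith⟩
              (fun s => by positivity) _
        _ = (1 - η ^ 2 / (1 + η)) * ∫ ω, (1 + η) ^ (X t ω).queue ∂P + (1 + η) := by
            rw [integral_add ((hint t).const_mul _) (integrable_const _), integral_const_mul]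
            simp
        _ ≤ (1 - η ^ 2 / (1 + η)) * ((1 + η) / η) ^ 2 + (1 + η) := by
            have : η ^ 2 / (1 + η) ≤ 1 := by
              rw [div_le_one (by linarith)]
              nlinarith
            gcongr
        _ = _ := by
            field_simp
            ring
  calc energy P X t ≤ ∫ ω, C * (1 + η) ^ (X t ω).queue ∂P := by
        refine integral_mono ((h.integrable_queue_sq t).add (h.integrable_queue t))
          ((hint t).const_mul C) fun ω => ?_
        dsimp only
        generalize (X t ω).queue = q
        have e1 : (1 + η) ^ q = Real.exp (θ * q) := by
          rw [hθ, mul_comm, Real.exp_nat_mul, Real.exp_log (by linarith)]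
        have e2 := Real.quadratic_le_exp_of_nonneg (x := θ * q) (by positivity)
        have e3 : 0 ≤ θ * q := by positivity
        rw [← e1] at e2
        have e4 : (q : ℝ) ^ 2 ≤ 2 / θ ^ 2 * (1 + η) ^ q := by
          rw [div_mul_eq_mul_div, le_div_iff₀ (by positivity)]
          nlinarith
        have e5 : (q : ℝ) ≤ 1 / θ * (1 + η) ^ q := by
          rw [div_mul_eq_mul_div, le_div_iff₀ (by positivity)]
          nlinarith [sq_nonneg (θ * q)]
        rw [hC, add_mul]
        linarith
    _ = C * ∫ ω, (1 + η) ^ (X t ω).queue ∂P := integral_const_mul _ _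
    _ ≤ _ := mul_le_mul_of_nonneg_left (hexp t) hC0.le

/-- The drift is an equality, so it telescopes to an exact formula. The benchmark is needed from
below, and it loses only the final energy term. -/
lemma sum_integral_queue_of_const [IsProbabilityMeasure P] (hm : 0 < m ∧ m < 1) {α : ℝ}
    (hαm : α < m) (ha : ∀ t ω, a t ω = α) (T : ℕ) :
    ∑ t ∈ Finset.range T, ∫ ω, ((X t ω).queue : ℝ) ∂P =
      T * geoMean α m - energy P X T / (2 * (m - α)) := by
  have hr : m - α ≠ 0 := by linarith
  induction T with
  | zero => simp [energy, h.zero, ServerState.empty]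
  | succ T ih =>
    rw [Finset.sum_range_succ, ih, h.energy_succ ⟨hm.1.le, hm.2.le⟩ α T]
    simp only [ha, sub_self, zero_mul, integral_zero, geoMean]
    push_cast
    field_simp
    ring

end IsAdaptiveQueue

/-! ### The drift recursion -/

/-- If the drift of `v` is `-2 r q + 2 c` up to errors of order `ε`, then the average of `q` is
`c / r` up to errors of order `ε`. -/
lemma sum_le_of_drift {v q ε : ℕ → ℝ} {r c : ℝ} {t₁ : ℕ} (hr : 0 < r) (hc1 : c ≤ 1)
    (hv : ∀ t, 0 ≤ v t) (hq : ∀ t, 0 ≤ q t) (hε : ∀ t, 0 ≤ ε t)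
    (hεr : ∀ t ≥ t₁, ε t ≤ r / 2) (hε1 : ∀ t ≥ t₁, ε t ≤ 1)
    (hanti : ∀ t ≥ t₁, ε (t + 1) ≤ ε t)
    (hdrift : ∀ t ≥ t₁, v (t + 1) ≤ v t - 2 * r * q t + 2 * c + 2 * (ε t * (q t + 2)))
    {T : ℕ} (hT : t₁ ≤ T) :
    ∑ t ∈ Finset.Ico t₁ T, q t ≤ (T - t₁) * (c / r) +
      (2 + 6 / r) / r * ∑ t ∈ Finset.Ico t₁ T, ε t + v t₁ * (1 + 1 / r) / r := by
  -- First a crude pass: half of the negative drift absorbs the error, leaving v(T+1) ≤ v T - r q T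
  -- + 6. Weighting by the decreasing ε makes the sum of ε q of the order of the sum of ε.
  have h1 : ε T * v T + r * ∑ t ∈ Finset.Ico t₁ T, ε t * q t ≤
      6 * ∑ t ∈ Finset.Ico t₁ T, ε t + ε t₁ * v t₁ := by
    induction T, hT using Nat.le_induction with
    | base => simp
    | succ T hT ih =>
      rw [Finset.sum_Ico_succ_top hT, Finset.sum_Ico_succ_top hT]
      have h2 := mul_le_mul_of_nonneg_right (hanti T hT) (hv (T + 1))
      have h3 : v (T + 1) ≤ v T - r * q T + 6 := by
        have := hdrift T hT
        have := mul_le_mul_of_nonneg_right (hεr T hT) (hq T)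
        have := hε1 T hT
        linarith
      have h4 := mul_le_mul_of_nonneg_left h3 (hε T)
      linarith
  -- Now the full drift is kept, so that the coefficient of T is the sharp c / r; the sum of ε q is
  -- supplied by the first pass.
  have h2 : v T + 2 * r * ∑ t ∈ Finset.Ico t₁ T, q t ≤ v t₁ + 2 * c * (T - t₁) +
      2 * ∑ t ∈ Finset.Ico t₁ T, ε t * q t + 4 * ∑ t ∈ Finset.Ico t₁ T, ε t := by
    clear h1
    induction T, hT using Nat.le_induction with
    | base => simp
    | succ T hT ih =>
      rw [Finset.sum_Ico_succ_top hT, Finset.sum_Ico_succ_top hT, Finset.sum_Ico_succ_top hT]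
      have := hdrift T hT
      push_cast
      linarith
  have h3 : ∑ t ∈ Finset.Ico t₁ T, ε t * q t ≤
      (6 * ∑ t ∈ Finset.Ico t₁ T, ε t + v t₁) / r := by
    rw [le_div_iff₀ hr]
    have h4 := mul_nonneg (hε T) (hv T)
    have h5 := mul_le_mul_of_nonneg_right (hε1 t₁ le_rfl) (hv t₁)
    linarith
  have h4 : ∑ t ∈ Finset.Ico t₁ T, q t ≤ (v t₁ + 2 * c * (T - t₁) +
      2 * ((6 * ∑ t ∈ Finset.Ico t₁ T, ε t + v t₁) / r) +
      4 * ∑ t ∈ Finset.Ico t₁ T, ε t) / (2 * r) := by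
    rw [le_div_iff₀ (by positivity)]
    linarith [hv T]
  refine h4.trans ?_
  have h5 : 0 ≤ v t₁ / r := div_nonneg (hv _) hr.le
  have e1 : (v t₁ + 2 * c * (T - t₁) +
      2 * ((6 * ∑ t ∈ Finset.Ico t₁ T, ε t + v t₁) / r) +
      4 * ∑ t ∈ Finset.Ico t₁ T, ε t) / (2 * r) = (T - t₁) * (c / r) +
      (2 + 6 / r) / r * ∑ t ∈ Finset.Ico t₁ T, ε t + v t₁ * (1 + 1 / r) / r - v t₁ / r / 2 := by
    field_simp
    ring
  linarith

/-! ### Systems of servers driven by independent slots -/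

lemma ProbabilityTheory.IndepFun.lintegral_comp_prodMk {Ω γ δ : Type*} [MeasurableSpace Ω]
    [MeasurableSpace γ] [MeasurableSpace δ] {P : Measure Ω} [IsProbabilityMeasure P] {Z : Ω → γ}
    {ξ : Ω → δ} (h : IndepFun Z ξ P) (hZ : Measurable Z) (hξ : Measurable ξ)
    {G : γ × δ → ℝ≥0∞} (hG : Measurable G) :
    ∫⁻ ω, G (Z ω, ξ ω) ∂P = ∫⁻ ω, ∫⁻ x, G (Z ω, x) ∂(P.map ξ) ∂P := by
  have : IsProbabilityMeasure (P.map ξ) := Measure.isProbabilityMeasure_map hξ.aemeasurable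
  rw [← lintegral_map hG (hZ.prodMk hξ),
    (indepFun_iff_map_prod_eq_prod_map_map hZ.aemeasurable hξ.aemeasurable).1 h,
    lintegral_prod _ hG.aemeasurable,
    lintegral_map hG.lintegral_prod_right' hZ]

open Classical in
lemma lintegral_ite_mem {R : Type*} [MeasurableSpace R] (ν : Measure R) [IsProbabilityMeasure ν]
    {B : Set R} (hB : MeasurableSet B) (c d : ℝ≥0∞) :
    ∫⁻ r, (if r ∈ B then c else d) ∂ν =
      ENNReal.ofReal (ν.real B) * c + ENNReal.ofReal (1 - ν.real B) * d := by
  have h1 : ∀ r, (if r ∈ B then c else d) = B.indicator (fun _ => c) r +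
      Bᶜ.indicator (fun _ => d) r := fun r => by by_cases h : r ∈ B <;> simp [h]
  simp_rw [h1]
  rw [lintegral_add_left (measurable_const.indicator hB), lintegral_indicator_const hB,
    lintegral_indicator_const hB.compl, ← probReal_compl_eq_one_sub hB, ofReal_measureReal,
    ofReal_measureReal, mul_comm, mul_comm d]

open Classical in
-- Identifies the law of one slot with `stepMean`; B collects the routing outcomes that select
-- server i, and the other servers' coins integrate out.
lemma lintegral_slot {K : ℕ} {lam : ℝ} (hlam : lam ∈ Set.Icc (0 : ℝ) 1) {μ : Fin K → ℝ}
    (hμ : ∀ i, 0 < μ i ∧ μ i < 1) {R : Type*} [MeasurableSpace R] (ν : Measure R)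
    [IsProbabilityMeasure ν] {B : Set R} (hB : MeasurableSet B) (i : Fin K)
    (g : ServerState → ℝ) (hg : ∀ s, 0 ≤ g s) (s : ServerState) :
    ∫⁻ x : Bool × (Fin K → Bool) × R, ENNReal.ofReal (g (s.next
        (if x.1 = true ∧ x.2.2 ∈ B then 1 else 0) (x.2.1 i)))
      ∂((coin lam).prod ((Measure.pi fun i => coin (μ i)).prod ν)) =
    ENNReal.ofReal (stepMean (μ i) (lam * ν.real B) g s) := by
  set f : ℕ → Bool → ℝ≥0∞ := fun d b => ENNReal.ofReal (g (s.next d b)) with hf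
  have hmeas : Measurable fun x : Bool × (Fin K → Bool) × R =>
      f (if x.1 = true ∧ x.2.2 ∈ B then 1 else 0) (x.2.1 i) := by
    have h1 : Measurable fun x : Bool × (Fin K → Bool) × R =>
        (if x.1 = true ∧ x.2.2 ∈ B then 1 else 0 : ℕ) := by
      refine Measurable.ite ?_ measurable_const measurable_const
      exact (measurable_fst (measurableSet_singleton true)).inter (measurable_snd.snd hB)
    have h2 : Measurable fun x : Bool × (Fin K → Bool) × R => x.2.1 i :=
      (measurable_pi_apply i).comp measurable_snd.fst
    exact (measurable_of_countable (fun z : ℕ × Bool => f z.1 z.2)).comp (h1.prodMk h2)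
  have hpi : ∀ φ : Bool → ℝ≥0∞, ∫⁻ S : Fin K → Bool, φ (S i) ∂(Measure.pi fun i => coin (μ i)) =
      ENNReal.ofReal (μ i) * φ true + ENNReal.ofReal (1 - μ i) * φ false := fun φ => by
    rw [← lintegral_coin (hμ i).1.le (hμ i).2.le, ←
      (measurePreserving_eval (fun i => coin (μ i)) i).map_eq,
      lintegral_map (measurable_of_countable _) (measurable_pi_apply i)]
  rw [lintegral_prod _ hmeas.aemeasurable, lintegral_coin hlam.1 hlam.2,
    lintegral_prod _ (by exact (hmeas.comp measurable_prodMk_left).aemeasurable),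
    lintegral_prod _ (by exact (hmeas.comp measurable_prodMk_left).aemeasurable)]
  have e1 : ∀ S : Fin K → Bool, ∫⁻ r, f (if (true, S, r).1 = true ∧ (true, S, r).2.2 ∈ B
      then 1 else 0) ((true, S, r).2.1 i) ∂ν =
      ENNReal.ofReal (ν.real B) * f 1 (S i) + ENNReal.ofReal (1 - ν.real B) * f 0 (S i) := by
    intro S
    rw [← lintegral_ite_mem ν hB]
    refine lintegral_congr fun r => ?_
    by_cases h : r ∈ B <;> simp [h]
  have e2 : ∀ S : Fin K → Bool, ∫⁻ r, f (if (false, S, r).1 = true ∧ (false, S, r).2.2 ∈ B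
      then 1 else 0) ((false, S, r).2.1 i) ∂ν = f 0 (S i) := by
    intro S
    simp
  refine (congrArg₂ (· + ·) (congrArg (ENNReal.ofReal lam * ·) (lintegral_congr e1))
    (congrArg (ENNReal.ofReal (1 - lam) * ·) (lintegral_congr e2))).trans ?_
  rw [hpi fun b => ENNReal.ofReal (ν.real B) * f 1 b + ENNReal.ofReal (1 - ν.real B) * f 0 b,
    hpi fun b => f 0 b]
  have hB0 : 0 ≤ ν.real B := measureReal_nonneg
  have hB1 : 0 ≤ 1 - ν.real B := by linarith [measureReal_le_one (μ := ν) (s := B)]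
  have hl0 := hlam.1
  have hl1 : 0 ≤ 1 - lam := by linarith [hlam.2]
  have hm0 := (hμ i).1.le
  have hm1 : 0 ≤ 1 - μ i := by linarith [(hμ i).2]
  have g1 := hg (s.next 1 true)
  have g2 := hg (s.next 1 false)
  have g3 := hg (s.next 0 true)
  have g4 := hg (s.next 0 false)
  simp only [hf]
  have hn : ∀ x y : ℝ, 0 ≤ x → 0 ≤ y → ENNReal.ofReal x * ENNReal.ofReal y =
      ENNReal.ofReal (x * y) := fun x y hx _ => (ENNReal.ofReal_mul hx).symm
  have ha : ∀ x y : ℝ, 0 ≤ x → 0 ≤ y → ENNReal.ofReal x + ENNReal.ofReal y =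
      ENNReal.ofReal (x + y) := fun x y hx hy => (ENNReal.ofReal_add hx hy).symm
  rw [hn _ _ hB0 g1, hn _ _ hB1 g3, hn _ _ hB0 g2, hn _ _ hB1 g4, ha _ _ (by positivity)
    (by positivity), ha _ _ (by positivity) (by positivity), hn _ _ hm0 (by positivity),
    hn _ _ hm1 (by positivity), hn _ _ hm0 (by positivity), hn _ _ hm1 (by positivity),
    ha _ _ (by positivity) (by positivity), ha _ _ (by positivity) (by positivity),
    hn _ _ hl0 (by positivity), hn _ _ hl1 (by positivity),
    ha _ _ (by positivity) (by positivity)]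
  congr 1
  unfold stepMean
  ring

/-- The filtration of the past of a sequence: at time `t`, everything before slot `t` is known. -/
def pastFiltration {Ω β : Type*} [mΩ : MeasurableSpace Ω] [mβ : MeasurableSpace β] (ξ : ℕ → Ω → β)
    (hξ : ∀ t, Measurable (ξ t)) : Filtration ℕ mΩ where
  seq t := ⨆ s ∈ Set.Iio t, mβ.comap (ξ s)
  mono' _ _ hst := biSup_mono fun _ hs => lt_of_lt_of_le hs hst
  le' _ := iSup₂_le fun s _ => (hξ s).comap_le

lemma measurable_pastFiltration {Ω β : Type*} [mΩ : MeasurableSpace Ω] [mβ : MeasurableSpace β]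
    {ξ : ℕ → Ω → β} (hξ : ∀ t, Measurable (ξ t)) {s t : ℕ} (hst : s < t) :
    Measurable[pastFiltration ξ hξ t] (ξ s) :=
  (comap_measurable (ξ s)).mono
    (le_iSup₂_of_le (f := fun s _ => mβ.comap (ξ s)) s hst le_rfl) le_rfl

lemma indepFun_pastFiltration {Ω β γ : Type*} [mΩ : MeasurableSpace Ω] [mβ : MeasurableSpace β]
    [MeasurableSpace γ] {P : Measure Ω} {ξ : ℕ → Ω → β} (hξ : ∀ t, Measurable (ξ t))
    (hind : iIndepFun ξ P) {t : ℕ} {Z : Ω → γ} (hZ : Measurable[pastFiltration ξ hξ t] Z) :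
    IndepFun Z (ξ t) P := by
  have h1 := indep_iSup_of_disjoint (S := Set.Iio t) (T := {t}) (fun s => (hξ s).comap_le) hind
    (by simp)
  rw [IndepFun_iff_Indep]
  refine indep_of_indep_of_le_left (indep_of_indep_of_le_right h1 ?_) hZ.comap_le
  simp

open Classical in
/-- Each server of a system whose routing in a slot is determined by the current state and
independent fresh randomness is an adaptive queue. -/
theorem isAdaptiveQueue_of_driven {K : ℕ} {lam : ℝ} (hlam : lam ∈ Set.Icc (0 : ℝ) 1)
    {μ : Fin K → ℝ} (hμ : ∀ i, 0 < μ i ∧ μ i < 1) {R : Type*} [MeasurableSpace R]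
    (ν : ℕ → Measure R) [∀ t, IsProbabilityMeasure (ν t)] {Ω : Type*} [mΩ : MeasurableSpace Ω]
    {P : Measure Ω} [IsProbabilityMeasure P] {ξ : ℕ → Ω → Bool × (Fin K → Bool) × R}
    (hξ : ∀ t, Measurable (ξ t)) (hind : iIndepFun ξ P)
    (hlaw : ∀ t, P.map (ξ t) =
      (coin lam).prod ((Measure.pi fun i => coin (μ i)).prod (ν t)))
    {B : ℕ → (Fin K → ServerState) → Fin K → Set R} (hB : ∀ t y i, MeasurableSet (B t y i))
    {Y : ℕ → Ω → Fin K → ServerState} (hY0 : ∀ ω i, Y 0 ω i = ServerState.empty)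
    (hY : ∀ t ω i, Y (t + 1) ω i = (Y t ω i).next
      (if (ξ t ω).1 = true ∧ (ξ t ω).2.2 ∈ B t (Y t ω) i then 1 else 0) ((ξ t ω).2.1 i))
    (i : Fin K) :
    IsAdaptiveQueue P (pastFiltration ξ hξ) (μ i) (fun t ω => Y t ω i)
      (fun t ω => lam * (ν t).real (B t (Y t ω) i)) := by
  -- The state space is countable, so joint measurability can be checked one state vector at a time,
  -- whatever the dependence of B on the state.
  have hnext : ∀ t i, Measurable fun z : (Fin K → ServerState) × (Bool × (Fin K → Bool) × R) =>
      (z.1 i).next (if z.2.1 = true ∧ z.2.2.2 ∈ B t z.1 i then 1 else 0) (z.2.2.1 i) := by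
    intro t i
    refine measurable_from_prod_countable_right fun y => ?_
    have h1 : Measurable fun x : Bool × (Fin K → Bool) × R =>
        (if x.1 = true ∧ x.2.2 ∈ B t y i then 1 else 0 : ℕ) := by
      refine Measurable.ite ?_ measurable_const measurable_const
      exact (measurable_fst (measurableSet_singleton true)).inter (measurable_snd.snd (hB t y i))
    have h2 : Measurable fun x : Bool × (Fin K → Bool) × R => x.2.1 i :=
      (measurable_pi_apply i).comp measurable_snd.fst
    exact (measurable_of_countable (fun z : ℕ × Bool => (y i).next z.1 z.2)).comp (h1.prodMk h2)
  have hYm : ∀ t, Measurable[pastFiltration ξ hξ t] (Y t) := by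
    intro t
    induction t with
    | zero =>
      have : Y 0 = fun _ _ => ServerState.empty := by funext ω i; exact hY0 ω i
      rw [this]
      exact measurable_const
    | succ t ih =>
      refine (@measurable_pi_iff Ω (Fin K) _ (pastFiltration ξ hξ (t + 1)) _ _).2 fun i => ?_
      simp_rw [hY t]
      exact (hnext t i).comp ((ih.mono ((pastFiltration ξ hξ).mono t.le_succ) le_rfl).prodMk
        (measurable_pastFiltration hξ t.lt_succ_self))
  refine ⟨fun ω => hY0 ω i, fun t ω => ⟨_, ?_, _, hY t ω i⟩,
    fun t => (measurable_pi_apply i).comp (hYm t), fun t => ?_, fun t ω => ?_, ?_⟩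
  · split_ifs <;> simp
  · exact (measurable_of_countable (fun y => lam * (ν t).real (B t y i))).comp (hYm t)
  · exact ⟨mul_nonneg hlam.1 measureReal_nonneg,
      mul_le_one₀ hlam.2 measureReal_nonneg measureReal_le_one⟩
  · intro t V g hV hg
    -- The weight and the state are frozen together: the pair is independent of slot t, which is
    -- then integrated out alone.
    have hZ : Measurable[pastFiltration ξ hξ t] fun ω => (V ω, Y t ω) := hV.prodMk (hYm t)
    have hle := (pastFiltration ξ hξ).le t
    have hG : Measurable fun z : (ℝ≥0∞ × (Fin K → ServerState)) ×
        (Bool × (Fin K → Bool) × R) => z.1.1 * ENNReal.ofReal (g ((z.1.2 i).next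
          (if z.2.1 = true ∧ z.2.2.2 ∈ B t z.1.2 i then 1 else 0) (z.2.2.1 i))) := by
      refine measurable_fst.fst.mul (ENNReal.measurable_ofReal.comp
        ((measurable_of_countable g).comp ?_))
      exact (hnext t i).comp (measurable_fst.snd.prodMk measurable_snd)
    have h1 := (indepFun_pastFiltration hξ hind hZ).lintegral_comp_prodMk
      (hZ.mono hle le_rfl) (hξ t) hG
    simp_rw [hY t]
    refine h1.trans (lintegral_congr fun ω => ?_)
    dsimp only
    rw [lintegral_const_mul, hlaw t, lintegral_slot hlam hμ (ν t) (hB t _ i) i g hg]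
    exact ENNReal.measurable_ofReal.comp ((measurable_of_countable g).comp
      ((hnext t i).comp measurable_prodMk_left))

/-! ### The two systems -/

instance : IsProbabilityMeasure unif01 := ⟨by simp [unif01]⟩

lemma setOf_picks {K : ℕ} (p : Fin K → ℝ) (i : Fin K) :
    {u | picks p u i} = Set.Ico (∑ j ∈ Finset.Iio i, p j) (∑ j ∈ Finset.Iic i, p j) := rfl

lemma measurableSet_picks {K : ℕ} (p : Fin K → ℝ) (i : Fin K) : MeasurableSet {u | picks p u i} :=
  measurableSet_Ico

/-- The probability that `i` is picked. -/
noncomputable def pickProb {K : ℕ} (p : Fin K → ℝ) (i : Fin K) : ℝ := unif01.real {u | picks p u i}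

lemma pickProb_nonneg {K : ℕ} (p : Fin K → ℝ) (i : Fin K) : 0 ≤ pickProb p i := measureReal_nonneg

/-- The cumulative sums stay in [0, 1], so the whole interval of length p i counts. For vectors not
known to be probability vectors only `pickProb` is meaningful. -/
lemma pickProb_eq {K : ℕ} {p : Fin K → ℝ} (hp0 : ∀ i, 0 ≤ p i) (hp1 : ∑ i, p i = 1) (i : Fin K) :
    pickProb p i = p i := by
  have h1 : ∑ j ∈ Finset.Iic i, p j = ∑ j ∈ Finset.Iio i, p j + p i := by
    rw [← Finset.Iio_insert, Finset.sum_insert (by simp), add_comm]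
  have h2 : ∑ j ∈ Finset.Iic i, p j ≤ 1 := by
    rw [← hp1]
    exact Finset.sum_le_sum_of_subset_of_nonneg (Finset.subset_univ _) fun j _ _ => hp0 j
  have h3 : 0 ≤ ∑ j ∈ Finset.Iio i, p j := Finset.sum_nonneg fun j _ => hp0 j
  have h4 : Set.Ico (∑ j ∈ Finset.Iio i, p j) (∑ j ∈ Finset.Iic i, p j) ∩ Set.Icc 0 1 =
      Set.Ico (∑ j ∈ Finset.Iio i, p j) (∑ j ∈ Finset.Iic i, p j) :=
    Set.inter_eq_left.2 fun x hx => ⟨h3.trans hx.1, hx.2.le.trans h2⟩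
  rw [pickProb, setOf_picks, unif01, measureReal_restrict_apply measurableSet_Ico, h4,
    Real.volume_real_Ico, h1, add_sub_cancel_left, max_eq_left (hp0 i)]

lemma explorationProb_mem (K t : ℕ) : explorationProb K t ∈ Set.Icc (0 : ℝ) 1 := by
  refine ⟨le_min zero_le_one ?_, min_le_left _ _⟩
  have := Real.log_natCast_nonneg t
  positivity

/-- The conditional probability that a slot brings a job to server `i`, if the estimates are `m`. -/
noncomputable def arrivalProb {K : ℕ} (lam : ℝ) (m : Fin K → ℝ) (t : ℕ) (i : Fin K) : ℝ :=
  lam * (explorationProb K t * (1 / K) +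
    (1 - explorationProb K t) * pickProb (routingVector lam m) i)

/-- The law of the routing randomness of a slot. -/
noncomputable def routingLaw (K t : ℕ) : Measure (Bool × Fin K × ℝ) :=
  (coin (explorationProb K t)).prod ((uniformOn (Set.univ : Set (Fin K))).prod unif01)

/-- The outcomes of the routing randomness that send a job to server `i`. -/
def routingSet {K : ℕ} (lam : ℝ) (m : Fin K → ℝ) (i : Fin K) : Set (Bool × Fin K × ℝ) :=
  {r | (r.1 = true ∧ r.2.1 = i) ∨ (r.1 = false ∧ picks (routingVector lam m) r.2.2 i)}

open Classical in
lemma dispatched_eq {K : ℕ} (lam : ℝ) (m : Fin K → ℝ) (x : Slot K) (i : Fin K) :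
    dispatched lam m x i = if x.1 = true ∧ x.2.2 ∈ routingSet lam m i then 1 else 0 := by
  obtain ⟨b, S, e, k, u⟩ := x
  simp only [dispatched]
  congr 1

lemma measurableSet_routingSet {K : ℕ} (lam : ℝ) (m : Fin K → ℝ) (i : Fin K) :
    MeasurableSet (routingSet lam m i) :=
  ((measurable_fst (measurableSet_singleton true)).inter
    (measurable_snd.fst (measurableSet_singleton i))).union
    ((measurable_fst (measurableSet_singleton false)).inter
      (measurable_snd.snd (measurableSet_picks _ i)))

instance (K : ℕ) [NeZero K] : IsProbabilityMeasure (uniformOn (Set.univ : Set (Fin K))) :=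
  isProbabilityMeasure_uniformOn Set.finite_univ Set.univ_nonempty

instance (K t : ℕ) [NeZero K] : IsProbabilityMeasure (routingLaw K t) := by
  unfold routingLaw; infer_instance

lemma mul_routingLaw_real_routingSet {K : ℕ} [NeZero K] (lam : ℝ) (m : Fin K → ℝ) (t : ℕ)
    (i : Fin K) : lam * (routingLaw K t).real (routingSet lam m i) = arrivalProb lam m t i := by
  obtain ⟨h0, h1⟩ := explorationProb_mem K t
  have e1 : Prod.mk true ⁻¹' routingSet lam m i = {i} ×ˢ Set.univ := by
    ext ⟨k, u⟩; simp [routingSet]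
  have e2 : Prod.mk false ⁻¹' routingSet lam m i =
      Set.univ ×ˢ {u | picks (routingVector lam m) u i} := by
    ext ⟨k, u⟩; simp [routingSet]
  have e3 : uniformOn (Set.univ : Set (Fin K)) {i} = ENNReal.ofReal (1 / K) := by
    rw [uniformOn_univ, Measure.count_singleton, Fintype.card_fin,
      ENNReal.ofReal_div_of_pos (by exact_mod_cast Nat.pos_of_neZero K)]
    simp
  have h2 : 0 ≤ 1 - explorationProb K t := by linarith
  rw [arrivalProb, measureReal_def, routingLaw,
    Measure.prod_apply (measurableSet_routingSet lam m i), lintegral_coin h0 h1, e1, e2,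
    Measure.prod_prod, Measure.prod_prod, measure_univ, measure_univ, mul_one, one_mul, e3,
    ← ofReal_measureReal, ← pickProb, ← ENNReal.ofReal_mul h0, ← ENNReal.ofReal_mul h2,
    ← ENNReal.ofReal_add (by positivity) (mul_nonneg h2 (pickProb_nonneg _ _)),
    ENNReal.toReal_ofReal (add_nonneg (by positivity) (mul_nonneg h2 (pickProb_nonneg _ _)))]

section Systems

variable {K : ℕ} {lam : ℝ} {μ : Fin K → ℝ} {Ω : Type*} [mΩ : MeasurableSpace Ω] {P : Measure Ω}
  [IsProbabilityMeasure P]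

/-- The estimates of the exploration policy in slot `t`. -/
noncomputable def estimates (lam : ℝ) (m₀ : Fin K → ℝ) (x : ℕ → Slot K) (t : ℕ) : Fin K → ℝ :=
  fun j => (learningState lam m₀ x t j).estimate (m₀ j)

theorem isAdaptiveQueue_learningState [NeZero K] (hlam : lam ∈ Set.Icc (0 : ℝ) 1)
    (hμ : ∀ i, 0 < μ i ∧ μ i < 1) {ξ : ℕ → Ω → Slot K} (hξ : ∀ t, Measurable (ξ t))
    (hind : iIndepFun ξ P) (hlaw : ∀ t, P.map (ξ t) = slotLaw lam μ t) (m₀ : Fin K → ℝ)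
    (i : Fin K) :
    IsAdaptiveQueue P (pastFiltration ξ hξ) (μ i)
      (fun t ω => learningState lam m₀ (fun s => ξ s ω) t i)
      (fun t ω => arrivalProb lam (estimates lam m₀ (fun s => ξ s ω) t) t i) := by
  have := isAdaptiveQueue_of_driven hlam hμ (routingLaw K) hξ hind hlaw
    (B := fun _ y i => routingSet lam (fun j => (y j).estimate (m₀ j)) i)
    (fun _ _ _ => measurableSet_routingSet _ _ _)
    (Y := fun t ω => learningState lam m₀ (fun s => ξ s ω) t) (fun _ _ => rfl)
    (fun t ω i => by simp only [learningState, dispatched_eq]) i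
  simp only [mul_routingLaw_real_routingSet] at this
  exact this

theorem isAdaptiveQueue_staticState (hlam : lam ∈ Set.Icc (0 : ℝ) 1)
    (hμ : ∀ i, 0 < μ i ∧ μ i < 1) {ζ : ℕ → Ω → StaticSlot K} (hζ : ∀ t, Measurable (ζ t))
    (hind : iIndepFun ζ P) (hlaw : ∀ t, P.map (ζ t) = staticSlotLaw lam μ) (p : Fin K → ℝ)
    (i : Fin K) :
    IsAdaptiveQueue P (pastFiltration ζ hζ) (μ i)
      (fun t ω => staticState p (fun s => ζ s ω) t i) (fun _ _ => lam * pickProb p i) :=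
  isAdaptiveQueue_of_driven hlam hμ (fun _ => unif01) hζ hind hlaw
    (B := fun _ _ i => {u | picks p u i}) (fun _ _ _ => measurableSet_picks _ _)
    (Y := fun t ω => staticState p (fun s => ζ s ω) t) (fun _ _ => rfl)
    (fun _ _ _ => rfl) i

end Systems

/-! ### Accuracy of the estimates -/

/-- The error equals (excess + m * age) / served. Its numerator is at most 2δ times the busy slots,
and served is at least half of them. The condition `δ < m` forces a departure, so the preset value
is not in use. -/
lemma ServerState.abs_estimate_sub_le {s : ServerState} {m δ n m₀ : ℝ} (hm : 0 < m ∧ m < 1)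
    (hδ : δ ≤ 1 / 2) (hδm : δ < m) (hn0 : 0 < n) (hn : n ≤ s.busySlots)
    (hex : |s.excess m| ≤ δ * s.busySlots) (hage : s.age ≤ δ * n) :
    |s.estimate m₀ - m| ≤ 4 * δ := by
  have hN : (0 : ℝ) < s.busySlots := by linarith
  have hδ0 : 0 ≤ δ := nonneg_of_mul_nonneg_left ((abs_nonneg _).trans hex) hN
  have hex' := abs_le.1 hex
  have hNe : (s.busySlots : ℝ) = s.served + s.age := by simp [busySlots]
  have hdep : (s.departed : ℝ) = s.excess m + m * s.busySlots := by simp [excess]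
  have hageN : (s.age : ℝ) ≤ δ * s.busySlots := hage.trans (mul_le_mul_of_nonneg_left hn hδ0)
  have hsrv : (s.busySlots : ℝ) / 2 ≤ s.served := by nlinarith
  have hsrv0 : (0 : ℝ) < s.served := by linarith
  have hd0 : s.departed ≠ 0 := by
    have : (0 : ℝ) < s.departed := by rw [hdep]; nlinarith
    exact_mod_cast this.ne'
  have hage0 : (0 : ℝ) ≤ s.age := by positivity
  have h1 : (s.departed : ℝ) / s.served - m = (s.excess m + m * s.age) / s.served := by
    rw [hdep, hNe]; field_simp; ring
  rw [estimate, if_neg hd0, h1, abs_div, abs_of_pos hsrv0, div_le_iff₀ hsrv0]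
  have h2 : m * s.age ≤ s.age := mul_le_of_le_one_left hage0 hm.2.le
  have h3 : 0 ≤ m * s.age := mul_nonneg hm.1.le hage0
  have h4 : 4 * δ * (s.busySlots / 2) ≤ 4 * δ * s.served :=
    mul_le_mul_of_nonneg_left hsrv (by linarith)
  rw [abs_le]
  constructor <;> linarith

/-- The rate in the tail bound for the estimates. -/
noncomputable def tailRate (m : ℝ) : ℝ := min (1 / 4) (Real.log (1 + m / 2))

lemma tailRate_pos {m : ℝ} (hm : 0 < m) : 0 < tailRate m :=
  lt_min (by norm_num) (Real.log_pos (by linarith))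

/-- A bad estimate requires few arrivals, a large excess, or a long unfinished service. As δ ≤ 1/2,
each of the exponents n, δ²n/4 and log(1 + m/2)δn is at least `tailRate m` times δ²n. -/
lemma IsAdaptiveQueue.measure_estimate_le {Ω : Type*} [mΩ : MeasurableSpace Ω] {P : Measure Ω}
    [IsProbabilityMeasure P] {ℱ : Filtration ℕ mΩ} {m : ℝ} {X : ℕ → Ω → ServerState}
    {a : ℕ → Ω → ℝ} (h : IsAdaptiveQueue P ℱ m X a) (hm : 0 < m ∧ m < 1) {δ n : ℝ} (hδ0 : 0 < δ)
    (hδ : δ ≤ 1 / 2) (hδm : δ < m) (hn : 0 < n) (m₀ : ℝ) (t : ℕ) :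
    P {ω | 4 * n ≤ ∑ s ∈ Finset.range t, a s ω ∧ 4 * δ < |(X t ω).estimate m₀ - m|} ≤
      ENNReal.ofReal ((3 + 2 / m) * Real.exp (-(tailRate m * (δ ^ 2 * n)))) := by
  have hsub : {ω | 4 * n ≤ ∑ s ∈ Finset.range t, a s ω ∧ 4 * δ < |(X t ω).estimate m₀ - m|} ⊆
      ({ω | ((X t ω).arrivals : ℝ) ≤ n ∧ 4 * n ≤ ∑ s ∈ Finset.range t, a s ω} ∪
      {ω | n ≤ (X t ω).busySlots ∧ δ * (X t ω).busySlots ≤ |(X t ω).excess m|}) ∪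
      {ω | δ * n ≤ (X t ω).age} := by
    rintro ω ⟨h1, h2⟩
    by_contra hω
    simp only [Set.mem_union, Set.mem_ofPred_eq, not_or, not_and, not_le] at hω
    obtain ⟨⟨h3, h4⟩, h5⟩ := hω
    have h6 : n ≤ (X t ω).busySlots := by
      have h7 : ((X t ω).arrivals : ℝ) ≤ (X t ω).busySlots := by
        exact_mod_cast h.arrivals_le_busySlots t ω
      by_contra h8
      exact absurd (h3 (by linarith)) (not_lt.2 h1)
    exact absurd (abs_estimate_sub_le hm hδ hδm hn h6 (h4 h6).le h5.le) (not_le.2 h2)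
  have hm0 := hm.1
  have hd2 : 0 ≤ δ ^ 2 * n := by positivity
  have e1 : Real.exp (-n) ≤ Real.exp (-(tailRate m * (δ ^ 2 * n))) := by
    apply Real.exp_le_exp.2
    have h1 := mul_le_mul_of_nonneg_right (min_le_left (1 / 4) (Real.log (1 + m / 2))) hd2
    have h2 : δ ^ 2 * n ≤ 1 * n := mul_le_mul_of_nonneg_right (by nlinarith) hn.le
    rw [tailRate]
    linarith
  have e2 : Real.exp (-(δ ^ 2 * n / 4)) ≤ Real.exp (-(tailRate m * (δ ^ 2 * n))) := by
    apply Real.exp_le_exp.2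
    have h1 := mul_le_mul_of_nonneg_right (min_le_left (1 / 4) (Real.log (1 + m / 2))) hd2
    rw [tailRate]
    linarith
  have e3 : Real.exp (-(Real.log (1 + m / 2) * (δ * n))) ≤
      Real.exp (-(tailRate m * (δ ^ 2 * n))) := by
    apply Real.exp_le_exp.2
    have h1 := mul_le_mul_of_nonneg_right (min_le_right (1 / 4) (Real.log (1 + m / 2))) hd2
    have h2 : 0 < Real.log (1 + m / 2) := Real.log_pos (by linarith)
    have h3 : δ ^ 2 * n ≤ δ * n := mul_le_mul_of_nonneg_right (by nlinarith) hn.le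
    have h4 := mul_le_mul_of_nonneg_left h3 h2.le
    rw [tailRate]
    linarith
  refine (measure_mono hsub).trans ((measure_union_le _ _).trans ((add_le_add
    ((measure_union_le _ _).trans (add_le_add (h.measure_arrivals_le hm n t)
      (h.measure_excess_le hm hδ0.le (by linarith) n t))) (h.measure_age_ge_le hm _ t)).trans ?_))
  rw [← ENNReal.ofReal_add (by positivity) (by positivity),
    ← ENNReal.ofReal_add (by positivity) (by positivity)]
  apply ENNReal.ofReal_le_ofReal
  have e4 := mul_le_mul_of_nonneg_left e3 (show 0 ≤ 2 / m by positivity)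
  linarith

/-! ### The routing function near the true rates -/

lemma exists_pos_forall_le {K : ℕ} (f : Fin K → ℝ) (hf : ∀ i, 0 < f i) : ∃ c > 0, ∀ i, c ≤ f i := by
  rcases isEmpty_or_nonempty (Fin K) with h | h
  · exact ⟨1, one_pos, fun i => (h.false i).elim⟩
  · obtain ⟨i, hi⟩ := Finite.exists_min f
    exact ⟨f i, hf i, hi⟩

lemma exists_tolerance {K : ℕ} {lam : ℝ} {μ : Fin K → ℝ} (h : 0 < toleranceGap lam μ) :
    ∃ δ : ℝ, 0 < δ ∧ ∀ m : Fin K → ℝ, (∀ i, m i ∈ Set.Icc (0 : ℝ) 1) → (∀ i, |m i - μ i| ≤ δ) →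
      optimalSupport lam m = optimalSupport lam μ := by
  unfold toleranceGap at h
  simp only [lt_iSup_iff] at h
  obtain ⟨δ, hδ, h0⟩ := h
  exact ⟨δ, by exact_mod_cast h0, hδ⟩

/-- Rates outside S may be replaced at will, in particular by the true ones; this removes poorly
sampled servers from the Lipschitz estimate. -/
lemma supportRouting_congr {K : ℕ} {lam : ℝ} {m m' : Fin K → ℝ} {S : Finset (Fin K)}
    (h : ∀ j ∈ S, m j = m' j) : supportRouting lam m S = supportRouting lam m' S := by
  have h1 : ∑ j ∈ S, m j = ∑ j ∈ S, m' j := Finset.sum_congr rfl h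
  have h2 : ∑ j ∈ S, spread (m j) = ∑ j ∈ S, spread (m' j) :=
    Finset.sum_congr rfl fun j hj => by rw [h j hj]
  funext i
  by_cases hi : i ∈ S
  · simp only [supportRouting, if_pos hi, share, h1, h2, h i hi]
  · simp only [supportRouting, if_neg hi]

lemma contDiffAt_supportRouting {K : ℕ} {lam : ℝ} {μ : Fin K → ℝ}
    (hμ : ∀ i, 0 < μ i ∧ μ i < 1) {S : Finset (Fin K)} (hS : S.Nonempty) :
    ContDiffAt ℝ 1 (fun m : Fin K → ℝ => supportRouting lam m S) μ := by
  have hproj : ∀ j : Fin K, ContDiffAt ℝ 1 (fun m : Fin K → ℝ => m j) μ := fun j =>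
    contDiffAt_pi.1 contDiffAt_id j
  have hspread : ∀ j : Fin K, ContDiffAt ℝ 1 (fun m : Fin K → ℝ => spread (m j)) μ := fun j =>
    ((hproj j).mul (contDiffAt_const.sub (hproj j))).sqrt
      (mul_pos (hμ j).1 (by linarith [(hμ j).2])).ne'
  have hsum : ContDiffAt ℝ 1 (fun m : Fin K → ℝ => ∑ j ∈ S, spread (m j)) μ :=
    ContDiffAt.sum fun j _ => hspread j
  have hne := (sum_spread_pos hμ hS).ne'
  rw [contDiffAt_pi]
  intro i
  by_cases hi : i ∈ S
  · have h1 : ContDiffAt ℝ 1 (fun m : Fin K → ℝ => m i / lam -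
        spread (m i) / (∑ j ∈ S, spread (m j)) * ((∑ j ∈ S, m j) / lam - 1)) μ :=
      ((hproj i).div_const _).sub (((hspread i).div hsum hne).mul
        (((ContDiffAt.sum fun j _ => hproj j).div_const _).sub contDiffAt_const))
    refine h1.congr_of_eventuallyEq ?_
    filter_upwards [hsum.continuousAt.eventually_ne hne] with m hm
    simp only [supportRouting, if_pos hi, share, if_neg hm]
  · simp only [supportRouting, if_neg hi]
    exact contDiffAt_const

/-- Near the true rates the routing function is a probability vector that is bounded below on the
support set and depends in a Lipschitz way on the rates of the support set only. -/
lemma exists_routingVector_close {K : ℕ} {lam : ℝ} {μ : Fin K → ℝ} (hlam : 0 < lam)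
    (hμ : ∀ i, 0 < μ i ∧ μ i < 1) (hstable : lam < ∑ i, μ i) (hgap : 0 < toleranceGap lam μ) :
    ∃ δ > 0, ∃ L > 0, ∃ α > 0, ∀ m : Fin K → ℝ, (∀ i, |m i - μ i| ≤ δ) →
      (∀ i, pickProb (routingVector lam m) i = routingVector lam m i) ∧
      (∀ i ∈ optimalSupport lam μ, α ≤ routingVector lam m i) ∧
      ∀ ε, (∀ j ∈ optimalSupport lam μ, |m j - μ j| ≤ ε) →
        ∀ i, |routingVector lam m i - routingVector lam μ i| ≤ L * ε := by
  set S := optimalSupport lam μ with hSdef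
  have hS : S.Nonempty := (isSupportCandidate_optimalSupport hlam hμ hstable).nonempty
  obtain ⟨δ₁, hδ₁, hsupp⟩ := exists_tolerance hgap
  obtain ⟨δ₂, hδ₂, hμ1⟩ := exists_pos_forall_le μ fun i => (hμ i).1
  obtain ⟨δ₃, hδ₃, hμ2⟩ := exists_pos_forall_le (fun i => 1 - μ i) fun i => by linarith [(hμ i).2]
  obtain ⟨L, V, hV, hL⟩ :=
    (contDiffAt_supportRouting (lam := lam) hμ hS).exists_lipschitzOnWith
  obtain ⟨δ₄, hδ₄, hball⟩ := Metric.nhds_basis_closedBall.mem_iff.1 hV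
  obtain ⟨α, hα, hαle⟩ := exists_pos_forall_le
    (fun i => if i ∈ S then routingVector lam μ i else 1) fun i => by
      split_ifs with hi
      · exact routingVector_pos hlam hμ hstable hi
      · exact one_pos
  have hL1 : (0 : ℝ) < L + 1 := by positivity
  -- In order: the support is unchanged, rates stay nonnegative and at most 1, they lie in the
  -- Lipschitz neighbourhood, and supported probabilities drop by at most half of α.
  set δ := min (min (min δ₁ δ₂) (min δ₃ δ₄)) (α / 2 / (L + 1)) with hδ
  have hδ0 : 0 < δ := by positivity
  refine ⟨δ, hδ0, L + 1, hL1, α / 2, by positivity, fun m hm => ?_⟩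
  have hle1 : δ ≤ δ₁ := (min_le_left _ _).trans ((min_le_left _ _).trans (min_le_left _ _))
  have hle2 : δ ≤ δ₂ := (min_le_left _ _).trans ((min_le_left _ _).trans (min_le_right _ _))
  have hle3 : δ ≤ δ₃ := (min_le_left _ _).trans ((min_le_right _ _).trans (min_le_left _ _))
  have hle4 : δ ≤ δ₄ := (min_le_left _ _).trans ((min_le_right _ _).trans (min_le_right _ _))
  have hle5 : (L + 1) * δ ≤ α / 2 := by
    have : δ ≤ α / 2 / (L + 1) := min_le_right _ _
    rw [le_div_iff₀ hL1] at this
    linarith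
  have hmem : ∀ i, m i ∈ Set.Icc (0 : ℝ) 1 := fun i => by
    have := abs_le.1 (hm i)
    have := hμ1 i
    have := hμ2 i
    constructor <;> linarith
  have hSm : optimalSupport lam m = S := hsupp m hmem fun i => (hm i).trans hle1
  have hrv : routingVector lam m = supportRouting lam m S := by rw [routingVector, hSm]
  have hclose : ∀ ε, (∀ j ∈ S, |m j - μ j| ≤ ε) →
      ∀ i, |routingVector lam m i - routingVector lam μ i| ≤ (L + 1) * ε := by
    intro ε hε i
    obtain ⟨j₀, hj₀⟩ := hS
    have hε0 : 0 ≤ ε := (abs_nonneg _).trans (hε j₀ hj₀)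
    -- A hybrid with true rates off S: its distance to μ sees only the supported coordinates.
    set m' : Fin K → ℝ := fun j => if j ∈ S then m j else μ j with hm'
    have hmm' : supportRouting lam m S = supportRouting lam m' S :=
      supportRouting_congr fun j hj => by simp [hm', hj]
    have hm'μ : ∀ η, 0 ≤ η → (∀ j ∈ S, |m j - μ j| ≤ η) → dist m' μ ≤ η := by
      intro η hη h
      rw [dist_pi_le_iff hη]
      intro j
      by_cases hj : j ∈ S
      · simp only [hm', if_pos hj, Real.dist_eq]
        exact h j hj
      · simp [hm', hj, hη]
    have hV' : m' ∈ V := hball (hm'μ δ₄ hδ₄.le fun j _ => (hm j).trans hle4)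
    have h1 := hL.dist_le_mul m' hV' μ (mem_of_mem_nhds hV)
    have h2 := (dist_le_pi_dist (supportRouting lam m' S) (supportRouting lam μ S) i).trans h1
    rw [hrv, hmm', routingVector, ← hSdef, ← Real.dist_eq]
    calc _ ≤ (L : ℝ) * dist m' μ := h2
      _ ≤ (L + 1) * ε := mul_le_mul (by linarith) (hm'μ ε hε0 hε) dist_nonneg hL1.le
  have hlow : ∀ i ∈ S, α / 2 ≤ routingVector lam m i := by
    intro i hi
    have h1 := hαle i
    rw [if_pos hi] at h1
    have h2 := (abs_le.1 (hclose δ (fun j _ => hm j) i)).1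
    linarith
  refine ⟨pickProb_eq (fun i => ?_) ?_, hlow, hclose⟩
  · by_cases hi : i ∈ S
    · exact (by positivity : (0 : ℝ) ≤ α / 2).trans (hlow i hi)
    · rw [hrv, supportRouting, if_neg hi]
  · rw [hrv]
    exact sum_supportRouting hS

/-! ### Accuracy of the routing -/

/-- The rate `√(log t / t)` at which the routing vector is learned. -/
noncomputable def learningRate (t : ℕ) : ℝ := √(Real.log t / t)

lemma learningRate_nonneg (t : ℕ) : 0 ≤ learningRate t := Real.sqrt_nonneg _

lemma log_div_nonneg (t : ℕ) : 0 ≤ Real.log t / t :=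
  div_nonneg (Real.log_natCast_nonneg t) (by positivity)

lemma learningRate_sq (t : ℕ) : learningRate t ^ 2 = Real.log t / t := Real.sq_sqrt (log_div_nonneg t)

lemma log_div_le_one (t : ℕ) : Real.log t / t ≤ 1 :=
  div_le_one_of_le₀ (Real.log_le_self (by positivity)) (by positivity)

lemma log_div_le_learningRate (t : ℕ) : Real.log t / t ≤ learningRate t := by
  rw [← learningRate_sq, sq]
  refine mul_le_of_le_one_left (learningRate_nonneg t) ?_
  exact (Real.sqrt_le_sqrt (log_div_le_one t)).trans_eq Real.sqrt_one

lemma one_le_log {t : ℕ} (ht : 3 ≤ t) : 1 ≤ Real.log t := by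
  rw [Real.le_log_iff_exp_le (by positivity)]
  have : (3 : ℝ) ≤ t := by exact_mod_cast ht
  linarith [Real.exp_one_lt_d9]

lemma inv_le_learningRate {t : ℕ} (ht : 3 ≤ t) : 1 / (t : ℝ) ≤ learningRate t :=
  (div_le_div_of_nonneg_right (one_le_log ht) (by positivity)).trans (log_div_le_learningRate t)

lemma learningRate_succ_le {t : ℕ} (ht : 3 ≤ t) : learningRate (t + 1) ≤ learningRate t := by
  have h3 : (3 : ℝ) ≤ t := by exact_mod_cast ht
  have he := Real.exp_one_lt_d9
  apply Real.sqrt_le_sqrt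
  exact Real.log_div_self_antitoneOn (by simp only [Set.mem_Ici]; linarith)
    (by simp only [Set.mem_Ici]; push_cast; linarith) (by push_cast; linarith)

lemma tendsto_learningRate : Filter.Tendsto learningRate Filter.atTop (nhds 0) := by
  have h1 : Filter.Tendsto (fun x : ℝ => Real.log x / x) Filter.atTop (nhds 0) :=
    Real.isLittleO_log_id_atTop.tendsto_div_nhds_zero
  have h2 := (h1.comp tendsto_natCast_atTop_atTop).sqrt
  rw [Real.sqrt_zero] at h2
  exact h2

/-- Discrete form of ∫ log u / u = log² s / 2. Since s + 1 ≤ s², an increment of log² is at most 3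
log s / s, so the factor 1/4 is ample. -/
lemma log_sq_le_sum {s : ℕ} (hs : 2 ≤ s) :
    (Real.log s ^ 2 - Real.log 2 ^ 2) / 4 ≤ ∑ u ∈ Finset.range s, Real.log u / u := by
  induction s, hs using Nat.le_induction with
  | base =>
    simpa using Finset.sum_nonneg fun u (_ : u ∈ Finset.range 2) => log_div_nonneg u
  | succ s hs ih =>
    rw [Finset.sum_range_succ]
    have hs2 : (2 : ℝ) ≤ s := by exact_mod_cast hs
    have hs0 : (0 : ℝ) < s := by linarith
    have hl0 : 0 ≤ Real.log s := Real.log_natCast_nonneg s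
    have h1 : Real.log (s + 1) - Real.log s ≤ 1 / s := by
      rw [← Real.log_div (by linarith) hs0.ne']
      have := Real.log_le_sub_one_of_pos (show 0 < ((s : ℝ) + 1) / s by positivity)
      have e : ((s : ℝ) + 1) / s - 1 = 1 / s := by field_simp; ring
      linarith
    have h2 : Real.log (s + 1) ≤ 2 * Real.log s := by
      have : Real.log ((s : ℝ) ^ 2) = 2 * Real.log s := by rw [Real.log_pow]; norm_num
      rw [← this]
      exact Real.log_le_log (by linarith) (by nlinarith)
    have h0 : Real.log s ≤ Real.log (s + 1) := Real.log_le_log hs0 (by linarith)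
    have h3 : (Real.log (s + 1) - Real.log s) * (Real.log (s + 1) + Real.log s) ≤
        1 / s * (3 * Real.log s) :=
      mul_le_mul h1 (by linarith) (by linarith) (by positivity)
    have h4 : Real.log s / s = 1 / s * Real.log s := by ring
    have h5 : 0 ≤ 1 / s * Real.log s := by positivity
    push_cast
    rw [h4]
    nlinarith

/-! ### Accuracy of one estimate with logarithmic and with linear sampling -/

namespace IsAdaptiveQueue

variable {Ω : Type*} [mΩ : MeasurableSpace Ω] {P : Measure Ω}
    [IsProbabilityMeasure P] {ℱ : Filtration ℕ mΩ} {m : ℝ} {X : ℕ → Ω → ServerState}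
    {a : ℕ → Ω → ℝ}

/-- With exploration alone, the estimate is eventually within any fixed tolerance. -/
lemma measure_estimate_le_of_exploration (h : IsAdaptiveQueue P ℱ m X a) (hm : 0 < m ∧ m < 1)
    {δ κ : ℝ} (hδ0 : 0 < δ) (hδ : δ ≤ 1 / 2) (hδm : δ < m) (hκ : 0 < κ)
    (ha : ∀ (t : ℕ) ω, κ * (Real.log t / t) ≤ a t ω) (m₀ : ℝ) {s : ℕ} (hs : 4 ≤ s) :
    P {ω | 4 * δ < |(X s ω).estimate m₀ - m|} ≤
      ENNReal.ofReal ((3 + 2 / m) * Real.exp (9 / (4 * (tailRate m * (δ ^ 2 * (κ / 32))))) /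
        (s : ℝ) ^ 3) := by
  have hs4 : (4 : ℝ) ≤ s := by exact_mod_cast hs
  have hs0 : (0 : ℝ) < s := by linarith
  have hlog : 0 < Real.log s := Real.log_pos (by linarith)
  have hm0 := hm.1
  have hn : 0 < κ * Real.log s ^ 2 / 32 := by positivity
  have htail := tailRate_pos hm0
  have hlog4 : 2 * Real.log 2 ≤ Real.log s := by
    have : Real.log ((2 : ℝ) ^ 2) = 2 * Real.log 2 := by rw [Real.log_pow]; norm_num
    rw [← this]
    exact Real.log_le_log (by norm_num) (by linarith)
  have hl2 : 0 < Real.log 2 := Real.log_pos (by norm_num)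
  have hsum : ∀ ω, 4 * (κ * Real.log s ^ 2 / 32) ≤ ∑ u ∈ Finset.range s, a u ω := by
    intro ω
    have h1 := Finset.sum_le_sum fun u (_ : u ∈ Finset.range s) => ha u ω
    rw [← Finset.mul_sum] at h1
    have h2 := mul_le_mul_of_nonneg_left (log_sq_le_sum (by omega : 2 ≤ s)) hκ.le
    have h3 : κ * (Real.log 2 ^ 2 * 4) ≤ κ * Real.log s ^ 2 :=
      mul_le_mul_of_nonneg_left (by nlinarith) hκ.le
    nlinarith
  have h1 := h.measure_estimate_le hm hδ0 hδ hδm hn m₀ s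
  simp only [hsum, true_and] at h1
  refine h1.trans (ENNReal.ofReal_le_ofReal ?_)
  rw [mul_div_assoc (3 + 2 / m)]
  refine mul_le_mul_of_nonneg_left ?_ (by positivity)
  set c := tailRate m * (δ ^ 2 * (κ / 32)) with hc
  have hc0 : 0 < c := by positivity
  have e1 : tailRate m * (δ ^ 2 * (κ * Real.log s ^ 2 / 32)) = c * Real.log s ^ 2 := by
    rw [hc]; ring
  have e2 : (s : ℝ) ^ 3 = Real.exp (3 * Real.log s) := by
    have := Real.exp_nat_mul (Real.log s) 3
    rw [Real.exp_log hs0] at this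
    rw [← this]
    norm_num
  rw [e1, e2, ← Real.exp_sub]
  apply Real.exp_le_exp.2
  -- Completing the square trades exp(-c log² s) for a constant times s⁻³. The cube leaves t⁻² after
  -- a union over a window of up to t slots.
  have e3 : 9 / (4 * c) - 3 * Real.log s + c * Real.log s ^ 2 =
      (3 - 2 * c * Real.log s) ^ 2 / (4 * c) := by
    field_simp
    ring
  have : 0 ≤ (3 - 2 * c * Real.log s) ^ 2 / (4 * c) := by positivity
  linarith

/-- With linearly many arrivals, the error of the estimate is of the order of `learningRate`. -/
lemma measure_estimate_le_of_linear (h : IsAdaptiveQueue P ℱ m X a) (hm : 0 < m ∧ m < 1)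
    {α : ℝ} (hα : 0 < α) (m₀ : ℝ) {t : ℕ} (ht : 3 ≤ t)
    (hδ : √(16 / (tailRate m * α)) * learningRate t ≤ 1 / 2)
    (hδm : √(16 / (tailRate m * α)) * learningRate t < m) :
    P {ω | α * t / 2 ≤ ∑ s ∈ Finset.range t, a s ω ∧
        4 * √(16 / (tailRate m * α)) * learningRate t < |(X t ω).estimate m₀ - m|} ≤
      ENNReal.ofReal ((3 + 2 / m) / (t : ℝ) ^ 2) := by
  have ht0 : (0 : ℝ) < t := by positivity
  have hlog := one_le_log ht
  have htail := tailRate_pos hm.1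
  have hlr : 0 < learningRate t := (by positivity : 0 < 1 / (t : ℝ)).trans_le (inv_le_learningRate ht)
  have hn : 0 < α * t / 8 := by positivity
  have h1 := h.measure_estimate_le hm (by positivity) hδ hδm hn m₀ t
  have e1 : 4 * (α * t / 8) = α * t / 2 := by ring
  -- The constant 16 is chosen so that the exponent is 2 log t, that is, a tail of t⁻².
  have e2 : tailRate m * ((√(16 / (tailRate m * α)) * learningRate t) ^ 2 * (α * t / 8)) =
      2 * Real.log t := by
    rw [mul_pow, Real.sq_sqrt (by positivity), learningRate_sq]
    field_simp
    norm_num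
  have e3 : Real.exp (-(2 * Real.log t)) = 1 / (t : ℝ) ^ 2 := by
    have := Real.exp_nat_mul (Real.log t) 2
    rw [Real.exp_log ht0] at this
    rw [Real.exp_neg, ← this]
    norm_num
  rw [e1, e2, e3, mul_one_div] at h1
  simpa only [mul_assoc] using h1

end IsAdaptiveQueue

/-! ### Arrival probabilities under the exploration policy -/

lemma log_div_le_explorationProb {K : ℕ} (hK : 1 ≤ K) (t : ℕ) :
    Real.log t / t ≤ explorationProb K t := by
  refine le_min (log_div_le_one t) ?_
  rw [mul_div_assoc]
  exact le_mul_of_one_le_left (log_div_nonneg t) (by exact_mod_cast hK)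

lemma explorationProb_le {K : ℕ} (t : ℕ) : explorationProb K t ≤ K * learningRate t := by
  refine (min_le_right _ _).trans ?_
  rw [mul_div_assoc]
  exact mul_le_mul_of_nonneg_left (log_div_le_learningRate t) (by positivity)

lemma mul_log_div_le_arrivalProb {K : ℕ} (hK : 1 ≤ K) {lam : ℝ} (hlam : 0 < lam)
    (m : Fin K → ℝ) (t : ℕ) (i : Fin K) :
    lam / K * (Real.log t / t) ≤ arrivalProb lam m t i := by
  have h0 := explorationProb_mem K t
  have h1 : 0 ≤ (1 - explorationProb K t) * pickProb (routingVector lam m) i :=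
    mul_nonneg (by linarith [h0.2]) (pickProb_nonneg _ _)
  have h2 : Real.log t / t * (1 / K) ≤ explorationProb K t * (1 / K) :=
    mul_le_mul_of_nonneg_right (log_div_le_explorationProb hK t) (by positivity)
  calc lam / K * (Real.log t / t) = lam * (Real.log t / t * (1 / K)) := by ring
    _ ≤ _ := mul_le_mul_of_nonneg_left (by linarith) hlam.le

/-- With probability `1 - O(t⁻²)` the arrival probabilities of the exploration policy in slot `t`
differ from the optimal ones by at most a multiple of `learningRate t`. -/
theorem exists_measure_arrivalProb_le {K : ℕ} {lam : ℝ} {μ : Fin K → ℝ} (hlam : 0 < lam)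
    (hlam1 : lam < 1) (hμ : ∀ i, 0 < μ i ∧ μ i < 1) (hstable : lam < ∑ i, μ i)
    (hgap : 0 < toleranceGap lam μ) :
    ∃ (C B : ℝ) (t₁ : ℕ), 0 < C ∧ 0 < B ∧ 3 ≤ t₁ ∧
      ∀ (m₀ : Fin K → ℝ) (Ω : Type*) [mΩ : MeasurableSpace Ω] (P : Measure Ω)
        [IsProbabilityMeasure P] (ℱ : Filtration ℕ mΩ) (X : Fin K → ℕ → Ω → ServerState),
        (∀ i, IsAdaptiveQueue P ℱ (μ i) (X i)
          (fun t ω => arrivalProb lam (fun j => (X j t ω).estimate (m₀ j)) t i)) →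
        ∀ t ≥ t₁, ∀ i, P {ω | C * learningRate t <
          |arrivalProb lam (fun j => (X j t ω).estimate (m₀ j)) t i -
            lam * routingVector lam μ i|} ≤ ENNReal.ofReal (B / (t : ℝ) ^ 2) := by
  have hK : 1 ≤ K := by
    by_contra hK
    obtain rfl : K = 0 := by omega
    simp at hstable
    linarith
  have hK0 : (0 : ℝ) < K := by exact_mod_cast hK
  obtain ⟨δ₀, hδ₀, L, hL, α, hα, hclose⟩ := exists_routingVector_close hlam hμ hstable hgap
  obtain ⟨μ₁, hμ₁, hμ₁le⟩ := exists_pos_forall_le μ fun i => (hμ i).1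
  set δ := min (δ₀ / 4) (min (1 / 2) (μ₁ / 2)) with hδdef
  have hδ : 0 < δ := by positivity
  have hδle : 4 * δ ≤ δ₀ := by linarith [min_le_left (δ₀ / 4) (min (1 / 2) (μ₁ / 2))]
  have hδ2 : δ ≤ 1 / 2 := (min_le_right _ _).trans (min_le_left _ _)
  have hδμ : ∀ i, δ < μ i := fun i => by
    have h1 : δ ≤ μ₁ / 2 := (min_le_right _ _).trans (min_le_right _ _)
    linarith [hμ₁le i]
  -- Routing mixes the uniform choice 1/K with a probability at least α on the support, so α' bounds
  -- the arrival probability of a supported server from below.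
  set α' := lam * min (1 / (K : ℝ)) α with hα'def
  have hα' : 0 < α' := by positivity
  set D := ∑ i, 4 * √(16 / (tailRate (μ i) * α')) with hD
  have hD0 : 0 ≤ D := Finset.sum_nonneg fun i _ => by positivity
  have hDi : ∀ i, 4 * √(16 / (tailRate (μ i) * α')) ≤ D := fun i =>
    Finset.single_le_sum (f := fun i => 4 * √(16 / (tailRate (μ i) * α')))
      (fun i _ => by positivity) (Finset.mem_univ i)
  set b : Fin K → ℝ := fun i =>
    (3 + 2 / μ i) * Real.exp (9 / (4 * (tailRate (μ i) * (δ ^ 2 * (lam / K / 32))))) with hb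
  have hb0 : ∀ i, 0 < b i := fun i => by
    have := (hμ i).1
    positivity
  have hev : ∀ᶠ t : ℕ in Filter.atTop, D * learningRate t < min (1 / 2) μ₁ := by
    have := tendsto_learningRate.const_mul D
    rw [mul_zero] at this
    exact this.eventually (gt_mem_nhds (by positivity))
  obtain ⟨t₁, ht₁⟩ := Filter.eventually_atTop.1 hev
  have hB0 : 0 ≤ ∑ i, (3 + 2 / μ i) := Finset.sum_nonneg fun i _ => by
    have := (hμ i).1
    positivity
  have hb0' : 0 ≤ ∑ i, b i := Finset.sum_nonneg fun i _ => (hb0 i).le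
  -- From t = 8 on, every slot of the window [t/2, t] is at least 4, as the exploration bound
  -- requires. The factor 64 = 4³ comes from s ≥ t/4 with rounding.
  refine ⟨K + L * D + 1, 64 * ∑ i, b i + ∑ i, (3 + 2 / μ i) + 1, max t₁ 8, by positivity,
    by positivity, by omega, fun m₀ Ω mΩ P _ ℱ X hX t ht i => ?_⟩
  have ht8 : 8 ≤ t := (le_max_right _ _).trans ht
  have ht0 : (0 : ℝ) < t := by positivity
  have hsmall := ht₁ t ((le_max_left _ _).trans ht)
  -- E: an estimate misses the fixed tolerance. G below: an estimate misses the fine accuracy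
  -- despite linearly many expected arrivals. Outside all of them the routing is accurate.
  set E : ℕ → Fin K → Set Ω := fun s j => {ω | 4 * δ < |(X j s ω).estimate (m₀ j) - μ j|} with hE
  set G : Fin K → Set Ω := fun j => {ω | α' * t / 2 ≤ ∑ s ∈ Finset.range t,
      arrivalProb lam (fun j => (X j s ω).estimate (m₀ j)) s j ∧
    4 * √(16 / (tailRate (μ j) * α')) * learningRate t <
      |(X j t ω).estimate (m₀ j) - μ j|} with hG
  have hsub : {ω | (K + L * D + 1) * learningRate t <
      |arrivalProb lam (fun j => (X j t ω).estimate (m₀ j)) t i - lam * routingVector lam μ i|} ⊆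
      (⋃ s ∈ Finset.Icc (t / 2) t, ⋃ j ∈ Finset.univ, E s j) ∪ ⋃ j ∈ Finset.univ, G j := by
    intro ω hω
    rw [Set.mem_ofPred_eq] at hω
    by_contra hnot
    simp only [Set.mem_union, Set.mem_iUnion, not_or, not_exists, Finset.mem_Icc,
      Finset.mem_univ, hE, hG, Set.mem_ofPred_eq, not_lt, not_and, forall_true_left] at hnot
    obtain ⟨hE', hG'⟩ := hnot
    have hnear : ∀ s, t / 2 ≤ s → s ≤ t → ∀ j, |(X j s ω).estimate (m₀ j) - μ j| ≤ δ₀ :=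
      fun s h1 h2 j => (hE' s ⟨h1, h2⟩ j).trans hδle
    have hpick := (hclose _ (hnear t (by omega) le_rfl)).1 i
    have hest : ∀ j ∈ optimalSupport lam μ,
        |(X j t ω).estimate (m₀ j) - μ j| ≤ D * learningRate t := by
      intro j hj
      refine (hG' j ?_).trans (mul_le_mul_of_nonneg_right (hDi j) (learningRate_nonneg t))
      -- The second half of the past alone already supplies an accumulated arrival probability of
      -- α't/2.
      have h1 : ∀ s ∈ Finset.Ico (t / 2) t,
          α' ≤ arrivalProb lam (fun j => (X j s ω).estimate (m₀ j)) s j := by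
        intro s hs
        obtain ⟨hs1, hs2⟩ := Finset.mem_Ico.1 hs
        obtain ⟨hp, hlow, -⟩ := hclose _ (hnear s hs1 hs2.le)
        obtain ⟨he0, he1⟩ := explorationProb_mem K s
        rw [arrivalProb, hp j]
        refine mul_le_mul_of_nonneg_left ?_ hlam.le
        have h2 := mul_le_mul_of_nonneg_left (min_le_left (1 / (K : ℝ)) α) he0
        have h3 := mul_le_mul_of_nonneg_left ((min_le_right (1 / (K : ℝ)) α).trans (hlow j hj))
          (sub_nonneg.2 he1)
        linarith
      have h2 := Finset.sum_le_sum h1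
      have h3 : ∑ s ∈ Finset.Ico (t / 2) t,
          arrivalProb lam (fun j => (X j s ω).estimate (m₀ j)) s j ≤
          ∑ s ∈ Finset.range t, arrivalProb lam (fun j => (X j s ω).estimate (m₀ j)) s j := by
        refine Finset.sum_le_sum_of_subset_of_nonneg (fun s hs => ?_) fun s _ _ =>
          ((hX j).prob_mem s ω).1
        exact Finset.mem_range.2 (Finset.mem_Ico.1 hs).2
      rw [Finset.sum_const, Nat.card_Ico, nsmul_eq_mul] at h2
      have h4 : (t : ℝ) / 2 ≤ ((t - t / 2 : ℕ) : ℝ) := by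
        have : t ≤ 2 * (t - t / 2) := by omega
        have : (t : ℝ) ≤ 2 * ((t - t / 2 : ℕ) : ℝ) := by exact_mod_cast this
        linarith
      have h5 := mul_le_mul_of_nonneg_right h4 hα'.le
      linarith
    have hroute := (hclose _ (hnear t (by omega) le_rfl)).2.2 _ hest i
    refine absurd hω (not_lt.2 ?_)
    obtain ⟨he0, he1⟩ := explorationProb_mem K t
    have hq := isStableRouting_routingVector hlam hμ hstable
    have hq0 := hq.1 i
    have hq1 : routingVector lam μ i ≤ 1 := by
      rw [← hq.2.1]
      exact Finset.single_le_sum (fun j _ => hq.1 j) (Finset.mem_univ i)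
    have e1 : arrivalProb lam (fun j => (X j t ω).estimate (m₀ j)) t i -
        lam * routingVector lam μ i = lam * (explorationProb K t *
          (1 / K - routingVector lam μ i) + (1 - explorationProb K t) *
          (routingVector lam (fun j => (X j t ω).estimate (m₀ j)) i - routingVector lam μ i)) := by
      rw [arrivalProb, hpick]
      ring
    have hK1 : 1 / (K : ℝ) ≤ 1 := by
      rw [div_le_one hK0]
      exact_mod_cast hK
    have hK2 : 0 ≤ 1 / (K : ℝ) := by positivity
    have h1 : |1 / (K : ℝ) - routingVector lam μ i| ≤ 1 :=
      abs_le.2 ⟨by linarith, by linarith⟩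
    rw [e1, abs_mul, abs_of_pos hlam]
    calc _ ≤ 1 * (|explorationProb K t * (1 / K - routingVector lam μ i)| +
          |(1 - explorationProb K t) * (routingVector lam
            (fun j => (X j t ω).estimate (m₀ j)) i - routingVector lam μ i)|) :=
          mul_le_mul hlam1.le (abs_add_le _ _) (abs_nonneg _) zero_le_one
      _ ≤ 1 * (K * learningRate t * 1 + 1 * (L * (D * learningRate t))) := by
          rw [abs_mul, abs_mul, abs_of_nonneg he0, abs_of_nonneg (sub_nonneg.2 he1)]
          refine mul_le_mul_of_nonneg_left (add_le_add ?_ ?_) zero_le_one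
          · exact mul_le_mul (explorationProb_le t) h1 (abs_nonneg _)
              (mul_nonneg hK0.le (learningRate_nonneg t))
          · exact mul_le_mul (by linarith) hroute (abs_nonneg _) zero_le_one
      _ ≤ _ := by linarith [learningRate_nonneg t]
  have hEm : ∀ s ∈ Finset.Icc (t / 2) t, P (⋃ j ∈ Finset.univ, E s j) ≤
      ENNReal.ofReal (64 * (∑ j, b j) / (t : ℝ) ^ 3) := by
    intro s hs
    obtain ⟨hs1, hs2⟩ := Finset.mem_Icc.1 hs
    have h4 : (t : ℝ) / 4 ≤ s := by
      have : t ≤ 4 * s := by omega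
      have : (t : ℝ) ≤ 4 * s := by exact_mod_cast this
      linarith
    refine (measure_biUnion_finset_le _ _).trans ((Finset.sum_le_sum fun j _ =>
      (hX j).measure_estimate_le_of_exploration (hμ j) hδ hδ2 (hδμ j)
        (show 0 < lam / K by positivity) (fun (t : ℕ) ω => mul_log_div_le_arrivalProb hK hlam _ t j)
        (m₀ j) (by omega)).trans ?_)
    rw [← ENNReal.ofReal_sum_of_nonneg fun j _ => by
      have := (hμ j).1
      positivity]
    apply ENNReal.ofReal_le_ofReal
    rw [← Finset.sum_div]
    have h5 : ((t : ℝ) / 4) ^ 3 ≤ (s : ℝ) ^ 3 := pow_le_pow_left₀ (by positivity) h4 3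
    calc (∑ j, b j) / (s : ℝ) ^ 3 ≤ (∑ j, b j) / ((t : ℝ) / 4) ^ 3 :=
          div_le_div_of_nonneg_left hb0' (by positivity) h5
      _ = _ := by field_simp; ring
  have hGm : P (⋃ j ∈ Finset.univ, G j) ≤
      ENNReal.ofReal ((∑ j, (3 + 2 / μ j)) / (t : ℝ) ^ 2) := by
    have hle : ∀ j, √(16 / (tailRate (μ j) * α')) * learningRate t ≤ D * learningRate t :=
      fun j => by
        have h1 := hDi j
        have h2 : 0 ≤ √(16 / (tailRate (μ j) * α')) := Real.sqrt_nonneg _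
        exact mul_le_mul_of_nonneg_right (by linarith) (learningRate_nonneg t)
    refine (measure_biUnion_finset_le _ _).trans ((Finset.sum_le_sum fun j _ =>
      (hX j).measure_estimate_le_of_linear (hμ j) hα' (m₀ j) (by omega)
        ((hle j).trans (hsmall.le.trans (min_le_left _ _)))
        ((hle j).trans_lt (hsmall.trans_le ((min_le_right _ _).trans (hμ₁le j))))).trans ?_)
    rw [← ENNReal.ofReal_sum_of_nonneg fun j _ => by
      have := (hμ j).1
      positivity, ← Finset.sum_div]
  refine (measure_mono hsub).trans ((measure_union_le _ _).trans ((add_le_add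
    ((measure_biUnion_finset_le _ _).trans (Finset.sum_le_sum hEm)) hGm).trans ?_))
  rw [Finset.sum_const, nsmul_eq_mul, Nat.card_Icc, ← ENNReal.ofReal_natCast,
    ← ENNReal.ofReal_mul (by positivity),
    ← ENNReal.ofReal_add (by positivity) (by positivity)]
  apply ENNReal.ofReal_le_ofReal
  have h6 : ((t + 1 - t / 2 : ℕ) : ℝ) ≤ t := by exact_mod_cast (by omega : t + 1 - t / 2 ≤ t)
  have h7 : 0 ≤ 64 * (∑ j, b j) / (t : ℝ) ^ 3 := by positivity
  calc _ ≤ t * (64 * (∑ j, b j) / (t : ℝ) ^ 3) + (∑ j, (3 + 2 / μ j)) / (t : ℝ) ^ 2 := by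
        gcongr
    _ = (64 * (∑ j, b j) + ∑ j, (3 + 2 / μ j)) / (t : ℝ) ^ 2 := by
        field_simp
    _ ≤ _ := div_le_div_of_nonneg_right (by linarith) (by positivity)

/-! ### The regret -/

/-- The drift recursion with error (C + 2B) `learningRate`: the bad event contributes B(t + 1)/t² ≤
2B/t, which is of no larger order. Slots before `t₀` and the energy at `t₀` enter only the constant,
through the bound Q(t) ≤ t. -/
lemma IsAdaptiveQueue.sum_integral_queue_le {Ω : Type*} [mΩ : MeasurableSpace Ω] {P : Measure Ω}
    [IsProbabilityMeasure P] {ℱ : Filtration ℕ mΩ} {m : ℝ} {X : ℕ → Ω → ServerState}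
    {a : ℕ → Ω → ℝ} (h : IsAdaptiveQueue P ℱ m X a) (hm : 0 < m ∧ m < 1) {α C B : ℝ}
    (hα0 : 0 ≤ α) (hαm : α < m) (hC : 0 ≤ C) (hB : 0 ≤ B) {t₀ : ℕ} (ht₀ : 3 ≤ t₀)
    (hsmall : ∀ t ≥ t₀, (C + 2 * B) * learningRate t ≤ min ((m - α) / 2) 1)
    (hP : ∀ t ≥ t₀, P {ω | C * learningRate t < |a t ω - α|} ≤ ENNReal.ofReal (B / (t : ℝ) ^ 2))
    {T : ℕ} (hT : t₀ ≤ T) :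
    ∑ t ∈ Finset.range T, ∫ ω, ((X t ω).queue : ℝ) ∂P ≤ T * geoMean α m +
      (2 + 6 / (m - α)) / (m - α) * (C + 2 * B) * ∑ t ∈ Finset.Ico t₀ T, learningRate t +
      ((t₀ : ℝ) ^ 2 + ((t₀ : ℝ) ^ 2 + t₀) * (1 + 1 / (m - α)) / (m - α)) := by
  have hr : 0 < m - α := by linarith
  have hq : ∀ t, 0 ≤ ∫ ω, ((X t ω).queue : ℝ) ∂P := fun t => integral_nonneg fun ω => by positivity
  have hqt : ∀ t, ∫ ω, ((X t ω).queue : ℝ) ∂P ≤ t := fun t => by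
    have : ∫ ω, ((X t ω).queue : ℝ) ∂P ≤ ∫ _, (t : ℝ) ∂P :=
      integral_mono (h.integrable_queue t) (integrable_const _)
        fun ω => Nat.cast_le.2 (h.queue_le t ω)
    simpa using this
  have hdrift : ∀ t ≥ t₀, energy P X (t + 1) ≤ energy P X t -
      2 * (m - α) * ∫ ω, ((X t ω).queue : ℝ) ∂P + 2 * (α * (1 - m)) +
      2 * ((C + 2 * B) * learningRate t * (∫ ω, ((X t ω).queue : ℝ) ∂P + 2)) := by
    intro t ht
    have ht3 : 3 ≤ t := ht₀.trans ht
    have ht0 : (0 : ℝ) < t := by positivity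
    have h1 : (1 : ℝ) ≤ t := by exact_mod_cast (by omega : 1 ≤ t)
    have hl := learningRate_nonneg t
    have h2 := h.integral_drift_le ⟨hm.1.le, hm.2.le⟩ ⟨hα0, by linarith [hm.2]⟩
      (mul_nonneg hC hl) (show 0 ≤ B / (t : ℝ) ^ 2 by positivity) t (hP t ht)
    have h3 : B / (t : ℝ) ^ 2 * (t + 1) ≤ 2 * B * learningRate t := by
      calc B / (t : ℝ) ^ 2 * (t + 1) ≤ B / (t : ℝ) ^ 2 * (t + t) := by gcongr
        _ = 2 * B * (1 / t) := by field_simp; ring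
        _ ≤ _ := mul_le_mul_of_nonneg_left (inv_le_learningRate ht3) (by positivity)
    have h4 : 0 ≤ C * learningRate t := mul_nonneg hC hl
    have h5 : 0 ≤ 2 * B * learningRate t := by positivity
    have h6 := mul_nonneg h5 (hq t)
    rw [h.energy_succ ⟨hm.1.le, hm.2.le⟩ α t]
    linarith
  have hmain := sum_le_of_drift (ε := fun t => (C + 2 * B) * learningRate t) hr
    (mul_le_one₀ (by linarith [hm.2]) (by linarith [hm.2]) (by linarith [hm.1]) : α * (1 - m) ≤ 1)
    (fun t => energy_nonneg (P := P) (X := X) t) hq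
    (fun t => mul_nonneg (by positivity) (learningRate_nonneg t))
    (fun t ht => (hsmall t ht).trans (min_le_left _ _))
    (fun t ht => (hsmall t ht).trans (min_le_right _ _))
    (fun t ht => mul_le_mul_of_nonneg_left (learningRate_succ_le (ht₀.trans ht)) (by positivity))
    hdrift hT
  have hgeo0 : 0 ≤ α * (1 - m) / (m - α) :=
    div_nonneg (mul_nonneg hα0 (by linarith [hm.2])) hr.le
  have h7 : ∑ t ∈ Finset.range t₀, ∫ ω, ((X t ω).queue : ℝ) ∂P ≤ (t₀ : ℝ) ^ 2 := by
    calc _ ≤ ∑ _t ∈ Finset.range t₀, (t₀ : ℝ) := Finset.sum_le_sum fun t ht =>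
          (hqt t).trans (by exact_mod_cast (Finset.mem_range.1 ht).le)
      _ = _ := by simp [sq]
  have h8 : energy P X t₀ * (1 + 1 / (m - α)) / (m - α) ≤
      ((t₀ : ℝ) ^ 2 + t₀) * (1 + 1 / (m - α)) / (m - α) := by
    have := h.energy_le t₀
    gcongr
  have h9 : ((T : ℝ) - t₀) * (α * (1 - m) / (m - α)) ≤ T * geoMean α m :=
    mul_le_mul_of_nonneg_right (by linarith [(Nat.cast_nonneg t₀ : (0 : ℝ) ≤ t₀)]) hgeo0
  rw [← Finset.mul_sum, ← mul_assoc] at hmain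
  rw [← Finset.sum_range_add_sum_Ico _ hT]
  linarith

lemma regret_eq {K : ℕ} (lam : ℝ) (m₀ p : Fin K → ℝ) (x : ℕ → Slot K) (y : ℕ → StaticSlot K)
    (t : ℕ) :
    regret lam m₀ p x y t = ∑ i,
      (∑ τ ∈ Finset.range (t + 1), ((learningState lam m₀ x τ i).queue : ℝ) -
        ∑ τ ∈ Finset.range (t + 1), ((staticState p y τ i).queue : ℝ)) := by
  have h : ∀ f : ℕ → ℝ, f 0 = 0 → ∑ τ ∈ Finset.Icc 1 t, f τ = ∑ τ ∈ Finset.range (t + 1), f τ := by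
    intro f hf
    rw [Finset.sum_range_succ', hf, add_zero, Finset.range_eq_Ico, Finset.sum_Ico_add' f 0 t 1]
    rfl
  rw [regret, h _ (by simp [learningState, staticState]), Finset.sum_comm]
  exact Finset.sum_congr rfl fun i _ => Finset.sum_sub_distrib _ _

/-- The expected regret up to time `t` is of the order of the sum of the learning rates. -/
theorem exists_integral_regret_le {K : ℕ} {lam : ℝ} (hlam0 : 0 < lam) (hlam1 : lam < 1)
    {μ : Fin K → ℝ} (hμ : ∀ i, 0 < μ i ∧ μ i < 1) (hstable : lam < ∑ i, μ i)
    (hgap : 0 < toleranceGap lam μ) :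
    ∃ (M : ℝ) (t₀ : ℕ) (C : ℝ), 0 < M ∧ 3 ≤ t₀ ∧
      ∀ (m₀ : Fin K → ℝ) (Ω : Type*) [MeasurableSpace Ω] (P : Measure Ω) [IsProbabilityMeasure P]
        (ξ : ℕ → Ω → Slot K) (ζ : ℕ → Ω → StaticSlot K),
        (∀ t, Measurable (ξ t)) → (∀ t, Measurable (ζ t)) →
        iIndepFun ξ P → (∀ t, P.map (ξ t) = slotLaw lam μ t) →
        iIndepFun ζ P → (∀ t, P.map (ζ t) = staticSlotLaw lam μ) →
        ∀ t : ℕ, t₀ ≤ t →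
          Integrable (fun ω => regret lam m₀ (routingVector lam μ)
            (fun s => ξ s ω) (fun s => ζ s ω) t) P ∧
          ∫ ω, regret lam m₀ (routingVector lam μ) (fun s => ξ s ω) (fun s => ζ s ω) t ∂P ≤
            M * ∑ τ ∈ Finset.Ico t₀ t, learningRate τ + C := by
  have hK : K ≠ 0 := by
    rintro rfl
    simp at hstable
    linarith
  have : NeZero K := ⟨hK⟩
  obtain ⟨C, B, t₁, hC, hB, ht₁, hclose⟩ :=
    exists_measure_arrivalProb_le hlam0 hlam1 hμ hstable hgap
  obtain ⟨hq0, hq1, hqμ⟩ := isStableRouting_routingVector hlam0 hμ hstable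
  set q := routingVector lam μ with hq
  have hlam : lam ∈ Set.Icc (0 : ℝ) 1 := ⟨hlam0.le, hlam1.le⟩
  obtain ⟨r, hr, hrle⟩ := exists_pos_forall_le (fun i => μ i - lam * q i)
    fun i => by linarith [hqμ i]
  have hev : ∀ᶠ t : ℕ in Filter.atTop, (C + 2 * B) * learningRate t < min (r / 2) 1 := by
    have := tendsto_learningRate.const_mul (C + 2 * B)
    rw [mul_zero] at this
    exact this.eventually (gt_mem_nhds (by positivity))
  obtain ⟨t₂, ht₂⟩ := Filter.eventually_atTop.1 hev
  set t₀ := max t₁ t₂ with ht₀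
  have hr0 : ∀ i, 0 < μ i - lam * q i := fun i => by linarith [hqμ i]
  set N : Fin K → ℝ := fun i => (2 + 6 / (μ i - lam * q i)) / (μ i - lam * q i) * (C + 2 * B)
    with hN
  have hN0 : ∀ i, 0 < N i := fun i => by have := hr0 i; positivity
  set D : Fin K → ℝ := fun i => (t₀ : ℝ) ^ 2 + ((t₀ : ℝ) ^ 2 + t₀) *
    (1 + 1 / (μ i - lam * q i)) / (μ i - lam * q i) with hD
  set E : Fin K → ℝ := fun i => (2 / Real.log (1 + (μ i - lam * q i) / 2) ^ 2 +
    1 / Real.log (1 + (μ i - lam * q i) / 2)) *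
      ((1 + (μ i - lam * q i) / 2) / ((μ i - lam * q i) / 2)) ^ 2 / (2 * (μ i - lam * q i)) with hE
  -- In the constant, D pays for the initial slots and E for the final energy of the benchmark. The
  -- extra N pays for the learning rate of slot t itself, since the queue sums run through t while
  -- the bound stops at t - 1.
  refine ⟨∑ i, N i, t₀, ∑ i, (N i + D i + E i),
    Finset.sum_pos (fun i _ => hN0 i) Finset.univ_nonempty, ht₁.trans (le_max_left _ _),
    fun m₀ Ω _ P _ ξ ζ hξ hζ hξi hξl hζi hζl t ht => ?_⟩
  have hX := fun i => isAdaptiveQueue_learningState hlam hμ hξ hξi hξl m₀ i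
  have hY : ∀ i, IsAdaptiveQueue P (pastFiltration ζ hζ) (μ i)
      (fun t ω => staticState q (fun s => ζ s ω) t i) (fun _ _ => lam * q i) := fun i => by
    have := isAdaptiveQueue_staticState hlam hμ hζ hζi hζl q i
    rwa [pickProb_eq hq0 hq1] at this
  simp_rw [regret_eq]
  have hXi := fun i => integrable_finsetSum (Finset.range (t + 1))
    fun τ _ => (hX i).integrable_queue τ
  have hYi := fun i => integrable_finsetSum (Finset.range (t + 1))
    fun τ _ => (hY i).integrable_queue τ
  refine ⟨integrable_finsetSum _ fun i _ => (hXi i).sub (hYi i), ?_⟩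
  rw [integral_finsetSum _ (by exact fun i _ => (hXi i).sub (hYi i)), Finset.sum_mul,
    ← Finset.sum_add_distrib]
  refine Finset.sum_le_sum fun i _ => ?_
  rw [integral_sub (hXi i) (hYi i),
    integral_finsetSum _ (by exact fun τ _ => (hX i).integrable_queue τ),
    integral_finsetSum _ (by exact fun τ _ => (hY i).integrable_queue τ),
    (hY i).sum_integral_queue_of_const (hμ i) (hqμ i) (fun _ _ => rfl) (t + 1)]
  have hα0 : 0 ≤ lam * q i := mul_nonneg hlam0.le (hq0 i)
  have h1 := (hX i).sum_integral_queue_le (t₀ := t₀) (T := t + 1) (hμ i) hα0 (hqμ i) hC.le hB.le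
    (ht₁.trans (le_max_left _ _))
    (fun s hs => (ht₂ s ((le_max_right _ _).trans hs)).le.trans
      (min_le_min_right _ (by linarith [hrle i])))
    (fun s hs => hclose m₀ Ω P (pastFiltration ξ hξ)
      (fun i t ω => learningState lam m₀ (fun s => ξ s ω) t i) hX s
      ((le_max_left _ _).trans hs) i) (ht.trans t.le_succ)
  have h2 : IsAdaptiveQueue.energy P (fun t ω => staticState q (fun s => ζ s ω) t i) (t + 1) /
      (2 * (μ i - lam * q i)) ≤ E i :=
    div_le_div_of_nonneg_right ((hY i).energy_le_of_const (hμ i) hα0 (hqμ i) (fun _ _ => rfl) (t + 1))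
      (by linarith [hr0 i])
  have h3 : learningRate t ≤ 1 :=
    (Real.sqrt_le_sqrt (log_div_le_one t)).trans_eq Real.sqrt_one
  have h4 := mul_le_mul_of_nonneg_left h3 (hN0 i).le
  rw [Finset.sum_Ico_succ_top ht, mul_add] at h1
  linarith

theorem theorem1 (K : ℕ) (lam : ℝ) (hlam0 : 0 < lam) (hlam1 : lam < 1)
    (μ : Fin K → ℝ) (hμ : ∀ i, 0 < μ i ∧ μ i < 1) (hstable : lam < ∑ i, μ i)
    (hgap : 0 < toleranceGap lam μ)
    (p : Fin K → ℝ) (hp : IsOptimalRouting lam μ p) :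
    ∃ (k₁ : ℝ) (t₀ : ℕ) (C : ℝ), 0 < k₁ ∧ 1 ≤ t₀ ∧
      ∀ m₀ : Fin K → ℝ, (∀ i, m₀ i ∈ Set.Icc (0 : ℝ) 1) →
      ∀ (Ω : Type*) [MeasurableSpace Ω] (P : Measure Ω) [IsProbabilityMeasure P]
        (ξ : ℕ → Ω → Slot K) (ζ : ℕ → Ω → StaticSlot K),
        iIndepFun ξ P → (∀ t, HasLaw (ξ t) (slotLaw lam μ t) P) →
        iIndepFun ζ P → (∀ t, HasLaw (ζ t) (staticSlotLaw lam μ) P) →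
        ∀ t : ℕ, t₀ ≤ t →
          Integrable (fun ω => regret lam m₀ p (fun s => ξ s ω) (fun s => ζ s ω) t) P ∧
          ∫ ω, regret lam m₀ p (fun s => ξ s ω) (fun s => ζ s ω) t ∂P ≤
            (∑ τ ∈ Finset.Ico t₀ t,
              ((∑ i with 0 < p i,
                  66 * k₁ * Real.log τ / (μ i - lam * p i) ^ 2 * √(Real.log τ / τ)) +
                ∑ i, 132 * Real.log τ ^ 2 / ((μ i - lam * p i) ^ 2 * τ))) + C := by
  obtain ⟨⟨hp0, hp1, hpμ⟩, -⟩ := id hp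
  obtain rfl := hp.eq_routingVector hlam0 hμ hstable
  set q := routingVector lam μ with hq
  obtain ⟨M, t₀, C, hM, ht₀, hmain⟩ := exists_integral_regret_le hlam0 hlam1 hμ hstable hgap
  -- One server with positive probability suffices to carry the whole bound.
  obtain ⟨i₀, hi₀⟩ : ∃ i, 0 < q i := by
    by_contra! hle
    have := Finset.sum_nonpos fun i (_ : i ∈ Finset.univ) => hle i
    linarith
  have hr₀ : 0 < μ i₀ - lam * q i₀ := by linarith [hpμ i₀]
  -- Makes the summand of `i₀` equal to M log τ √(log τ / τ), which exceeds the required M √(log τ /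
  -- τ) because log τ ≥ 1 for τ ≥ 3.
  set k₁ := M * (μ i₀ - lam * q i₀) ^ 2 / 66 with hk₁
  have hk₁0 : 0 < k₁ := by positivity
  refine ⟨k₁, t₀, C, hk₁0, by omega, fun m₀ _ Ω _ P _ ξ ζ hξi hξl hζi hζl t ht => ?_⟩
  -- `HasLaw` gives only almost everywhere measurability, whereas the filtration of the past needs
  -- measurable slots. Countably many modifications change the regret only on a null set.
  set ξ' : ℕ → Ω → Slot K := fun t => (hξl t).aemeasurable.mk (ξ t)
  set ζ' : ℕ → Ω → StaticSlot K := fun t => (hζl t).aemeasurable.mk (ζ t)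
  have hξe : ∀ t, ξ t =ᵐ[P] ξ' t := fun t => (hξl t).aemeasurable.ae_eq_mk
  have hζe : ∀ t, ζ t =ᵐ[P] ζ' t := fun t => (hζl t).aemeasurable.ae_eq_mk
  obtain ⟨hint, hle⟩ := hmain m₀ Ω P ξ' ζ' (fun t => (hξl t).aemeasurable.measurable_mk)
    (fun t => (hζl t).aemeasurable.measurable_mk) (hξi.congr hξe)
    (fun t => (Measure.map_congr (hξe t)).symm.trans (hξl t).map_eq) (hζi.congr hζe)
    (fun t => (Measure.map_congr (hζe t)).symm.trans (hζl t).map_eq) t ht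
  have hae : (fun ω => regret lam m₀ q (fun s => ξ s ω) (fun s => ζ s ω) t) =ᵐ[P]
      fun ω => regret lam m₀ q (fun s => ξ' s ω) (fun s => ζ' s ω) t := by
    filter_upwards [ae_all_iff.2 hξe, ae_all_iff.2 hζe] with ω h1 h2
    simp_rw [h1, h2]
  refine ⟨hint.congr hae.symm, ?_⟩
  rw [integral_congr_ae hae]
  refine hle.trans (add_le_add ?_ le_rfl)
  rw [Finset.mul_sum]
  refine Finset.sum_le_sum fun τ hτ => ?_
  have hlog := one_le_log (ht₀.trans (Finset.mem_Ico.1 hτ).1)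
  have h1 : M * learningRate τ ≤
      66 * k₁ * Real.log τ / (μ i₀ - lam * q i₀) ^ 2 * √(Real.log τ / τ) := by
    have e1 : 66 * k₁ * Real.log τ / (μ i₀ - lam * q i₀) ^ 2 = M * Real.log τ := by
      rw [hk₁]; field_simp
    rw [e1]
    exact mul_le_mul_of_nonneg_right (le_mul_of_one_le_right hM.le hlog) (learningRate_nonneg τ)
  have h2 : 66 * k₁ * Real.log τ / (μ i₀ - lam * q i₀) ^ 2 * √(Real.log τ / τ) ≤
      ∑ i with 0 < q i, 66 * k₁ * Real.log τ / (μ i - lam * q i) ^ 2 * √(Real.log τ / τ) :=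
    Finset.single_le_sum
      (f := fun i => 66 * k₁ * Real.log τ / (μ i - lam * q i) ^ 2 * √(Real.log τ / τ))
      (fun i _ => by positivity) (by simpa using hi₀)
  have h3 : 0 ≤ ∑ i, 132 * Real.log τ ^ 2 / ((μ i - lam * q i) ^ 2 * τ) :=
    Finset.sum_nonneg fun i _ => by positivity
  linarith
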